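/- Let $k\ge 0$ and $\delta\ge k+2$ be integers. For a finite simple graph $G$, let $\delta(G)$ be its minimum degree and let $q(G)$ be the largest eigenvalue of its signless Laplacian matrix $Q(G)=D(G)+A(G)$, where $D(G)$ is the diagonal matrix of vertex degrees and $A(G)$ is the adjacency matrix. The graph $G=(V,E)$ is called $k$-Hamiltonian if for every $S\subseteq V$ with $|S|\le k$ the subgraph induced by $V\setminus S$ contains a Hamilton cycle. Write $K_s$ for the complete graph and $I_s$ for the edgeless graph on $s$ vertices, $\cup$ for disjoint union, $\vee$ for join, and $G\setminus E'$ for the graph obtained from $G$ by deleting the edges in $E'$. Put $$H_{n,k,\delta}=K_\delta\vee(K_{n-2\delta+k}\cup I_{\delta-k}),\qquad L_{n,k,\delta}=K_{k+1}\vee(K_{n-\delta-1}\cup K_{\delta-k}).$$ In each of these two graphs let $Y$ be the vertex set of the first clique ($K_\delta$, respectively $K_{k+1}$), let $Z$ be the vertex set of the large clique ($K_{n-2\delta+k}$, respectively $K_{n-\delta-1}$), and let $E_1(\cdot)$ be the set of edges with both endpoints in $Y\cup Z$. Define, up to isomorphism, $$\mathcal H^{(1)}_{n,k,\delta}=\{H_{n,k,\delta}\setminus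 E' : E'\subseteq E_1(H_{n,k,\delta}),\ |E'|\le\lfloor\delta(\delta-k)/4\rfloor\},$$ $$\mathcal L^{(1)}_{n,k,\delta}=\{L_{n,k,\delta}\setminus E' : E'\subseteq E_1(L_{n,k,\delta}),\ |E'|\le\lfloor(k+1)(\delta-k)/4\rfloor\}.$$ Theorem. There is an integer $N$, depending only on $k$ and $\delta$, such that for all $n\ge N$ the following holds. If $G$ is an $n$-vertex graph with minimum degree $\delta(G)\ge\delta$ and $q(G)\ge 2(n-\delta+k-1)$, then $G$ is $k$-Hamiltonian unless $G\in\mathcal H^{(1)}_{n,k,\delta}$ or $G\in\mathcal L^{(1)}_{n,k,\delta}$, and in these exceptional cases $G$ is not $k$-Hamiltonian. -/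

import Mathlib

namespace KHam

/-- The join `G ∨ H`: the disjoint union together with all edges between the two parts. -/
def join {V W : Type*} (G : SimpleGraph V) (H : SimpleGraph W) : SimpleGraph (V ⊕ W) :=
  (G ⊕g H) ⊔ completeBipartiteGraph V W

/-- `G` contains a Hamilton cycle, i.e. a cycle through all vertices. -/
def HasHamiltonCycle {V : Type*} [DecidableEq V] (G : SimpleGraph V) : Prop :=
  ∃ (v : V) (p : G.Walk v v), p.IsHamiltonianCycle

/-- `G` is `k`-Hamiltonian: for every set `S` of at most `k` vertices, the subgraph induced by
the complement of `S` has a Hamilton cycle. -/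
def IsKHamiltonian {V : Type*} [DecidableEq V] (G : SimpleGraph V) (k : ℕ) : Prop :=
  ∀ S : Finset V, S.card ≤ k → HasHamiltonCycle (G.induce {v | v ∉ S})

/-- The signless Laplacian matrix `Q(G) = D(G) + A(G)`. -/
def signlessLaplacian {V : Type*} [Fintype V] [DecidableEq V] (G : SimpleGraph V)
    [DecidableRel G.Adj] : Matrix V V ℝ :=
  G.degMatrix ℝ + G.adjMatrix ℝ

/-- The signless Laplacian spectral radius `q(G)`: the largest eigenvalue of `Q(G)`. -/
noncomputable def q {V : Type*} [Fintype V] [DecidableEq V] (G : SimpleGraph V)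
    [DecidableRel G.Adj] : ℝ :=
  sSup {μ : ℝ | Module.End.HasEigenvalue (Matrix.toLin' (signlessLaplacian G)) μ}

/-- On a nonempty vertex set, `q(G)` really is an eigenvalue, and the largest one. -/
theorem q_isGreatest {V : Type*} [Fintype V] [DecidableEq V] [Nonempty V] (G : SimpleGraph V)
    [DecidableRel G.Adj] :
    IsGreatest {μ : ℝ | Module.End.HasEigenvalue (Matrix.toLin' (signlessLaplacian G)) μ}
      (q G) := by
  have hQ : (signlessLaplacian G).IsHermitian := by
    refine Matrix.IsHermitian.add ?_ ?_
    · exact Matrix.isHermitian_diagonal _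
    · rw [Matrix.IsHermitian, Matrix.conjTranspose_eq_transpose_of_trivial]
      exact SimpleGraph.transpose_adjMatrix G
  have hfin : {μ : ℝ | Module.End.HasEigenvalue
      (Matrix.toLin' (signlessLaplacian G)) μ}.Finite :=
    Module.End.finite_hasEigenvalue _
  have hne : {μ : ℝ | Module.End.HasEigenvalue
      (Matrix.toLin' (signlessLaplacian G)) μ}.Nonempty := by
    obtain ⟨v⟩ := ‹Nonempty V›
    refine ⟨hQ.eigenvalues v, ?_⟩
    rw [Set.mem_ofPred_eq, Module.End.hasEigenvalue_iff_mem_spectrum, Matrix.spectrum_toLin']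
    exact hQ.eigenvalues_mem_spectrum_real v
  exact ⟨hne.csSup_mem hfin, fun μ hμ => le_csSup hfin.bddAbove hμ⟩

/-- `H_{n,k,δ} = K_δ ∨ (K_{n-2δ+k} ∪ I_{δ-k})`. The three summands of the vertex type are
`Y`, `Z` and `X`, in this order. It has `n` vertices when `k ≤ δ` and `2δ - k ≤ n`. -/
def graphH (n k δ : ℕ) : SimpleGraph (Fin δ ⊕ (Fin (n + k - 2 * δ) ⊕ Fin (δ - k))) :=
  join (⊤ : SimpleGraph (Fin δ))
    ((⊤ : SimpleGraph (Fin (n + k - 2 * δ))) ⊕g (⊥ : SimpleGraph (Fin (δ - k))))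

/-- `L_{n,k,δ} = K_{k+1} ∨ (K_{n-δ-1} ∪ K_{δ-k})`. The three summands of the vertex type are
`Y`, `Z` and `X`, in this order. It has `n` vertices when `k ≤ δ` and `δ + 1 ≤ n`. -/
def graphL (n k δ : ℕ) : SimpleGraph (Fin (k + 1) ⊕ (Fin (n - δ - 1) ⊕ Fin (δ - k))) :=
  join (⊤ : SimpleGraph (Fin (k + 1)))
    ((⊤ : SimpleGraph (Fin (n - δ - 1))) ⊕g (⊤ : SimpleGraph (Fin (δ - k))))

/-- In a three-part vertex type, the union `Y ∪ Z` of the first two parts. -/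
def partYZ (Y Z X : Type*) : Set (Y ⊕ (Z ⊕ X)) :=
  Set.range Sum.inl ∪ Set.range (Sum.inr ∘ Sum.inl)

/-- The edges of `G` with both endpoints in `Y ∪ Z`. -/
def edgesYZ {Y Z X : Type*} (G : SimpleGraph (Y ⊕ (Z ⊕ X))) : Set (Sym2 (Y ⊕ (Z ⊕ X))) :=
  {e | e ∈ G.edgeSet ∧ ∀ v ∈ e, v ∈ partYZ Y Z X}

/-- Membership (up to isomorphism) in the family of graphs `H_{n,k,δ} \ E'`, where `E'` consists
of at most `⌊δ(δ-k)/4⌋` edges of `H_{n,k,δ}` with both endpoints in `Y ∪ Z`. -/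
def InFamilyH (n k δ : ℕ) {V : Type*} (G : SimpleGraph V) : Prop :=
  ∃ E' : Finset (Sym2 (Fin δ ⊕ (Fin (n + k - 2 * δ) ⊕ Fin (δ - k)))),
    (E' : Set (Sym2 _)) ⊆ edgesYZ (graphH n k δ) ∧
    E'.card ≤ δ * (δ - k) / 4 ∧
    Nonempty (G ≃g (graphH n k δ).deleteEdges (E' : Set (Sym2 _)))

/-- Membership (up to isomorphism) in the family of graphs `L_{n,k,δ} \ E'`, where `E'` consists
of at most `⌊(k+1)(δ-k)/4⌋` edges of `L_{n,k,δ}` with both endpoints in `Y ∪ Z`. -/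
def InFamilyL (n k δ : ℕ) {V : Type*} (G : SimpleGraph V) : Prop :=
  ∃ E' : Finset (Sym2 (Fin (k + 1) ⊕ (Fin (n - δ - 1) ⊕ Fin (δ - k)))),
    (E' : Set (Sym2 _)) ⊆ edgesYZ (graphL n k δ) ∧
    E'.card ≤ (k + 1) * (δ - k) / 4 ∧
    Nonempty (G ≃g (graphL n k δ).deleteEdges (E' : Set (Sym2 _)))

end KHam

/-! Put s = δ - k. The spectral hypothesis becomes q(G) ≥ 2(n - s - 1), the radius of K_{n-s}.
Weighting vertices by their degrees turns this into an edge count (`le_sum_degree_of_le_q`): at most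
2sn ordered pairs of distinct vertices are nonadjacent.

Suppose |S| ≤ k and G - S has no Hamilton cycle. Let T be the complement of S and C ⊇ G a maximal
graph without a cycle on T. By Ore's argument, vertices whose degrees in T sum to at least |T| are
adjacent in C. As few edges are missing, this is rigid (`structure_of_not_hamOn`): T consists of a
clique and a set X of s vertices of degree exactly s, all attached to the same set Y of clique
vertices, with 1 ≤ |Y| ≤ s. If 1 < |Y| < s there is a cycle on T, so either |Y| = 1 and X is a
clique, or |Y| = s and X is independent. Degrees in G are at least k + s, so equality holds
throughout: G and C agree at X within T, |S| = k, and X is completely joined to S. Now S ∪ Y is the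
first part of L or of H (`exists_parts_of_not_hamOn`).

It remains to bound the number m of edges missing outside X. Take the indicator vector of the
complement of X: compared with K_{n-s}, each edge from X to the attachment set adds 1 to the
quadratic form of Q, and each missing edge removes 4. So 4m should not exceed |X| times the size of
that set. `four_mul_card_missing_le` proves this for large n by perturbing the vector and applying a
Collatz–Wielandt bound.

Conversely, the deleted edges never touch X, so removing k suitable vertices leaves a cut vertex (L)
or an independent set with too few neighbours (H). -/

open Finset

namespace KHam

/-! ### Hamilton cycles as cyclic lists -/

section Cycles

variable {V : Type*} [DecidableEq V]

/-- `G` has a cycle with vertex set exactly `T`, presented as a cyclic list. -/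
def HamOn (G : SimpleGraph V) (T : Finset V) : Prop :=
  ∃ l : List V, l.Nodup ∧ l.toFinset = T ∧ 3 ≤ l.length ∧ l.IsChain G.Adj ∧
    ∀ x ∈ l.getLast?, ∀ y ∈ l.head?, G.Adj x y

theorem hasHamiltonCycle_of_hamOn_univ [Fintype V] {G : SimpleGraph V} (h : HamOn G univ) :
    HasHamiltonCycle G := by
  obtain ⟨l, h1, h2, h3, h4, h5⟩ := h
  have hne : l ≠ [] := by rintro rfl; simp at h3
  have hadj : G.Adj (l.getLast hne) (l.head hne) :=
    h5 _ (List.getLast_mem_getLast? hne) _ (List.head_mem_head? hne)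
  set w := SimpleGraph.Walk.ofSupport l hne h4 with hw
  have hs : w.support = l := SimpleGraph.Walk.support_ofSupport hne h4
  have hp : w.IsPath := by
    rw [SimpleGraph.Walk.isPath_def, hs]; exact h1
  have hlen : w.length + 1 = l.length := by
    rw [← SimpleGraph.Walk.length_support, hs]
  refine ⟨_, .cons hadj w, ?_⟩
  rw [SimpleGraph.Walk.isHamiltonianCycle_isCycle_and_isHamiltonian_tail]
  constructor
  · rw [SimpleGraph.Walk.cons_isCycle_iff]
    refine ⟨hp, fun he => ?_⟩
    rw [Sym2.eq_swap] at he
    -- The closing edge can lie on the path only if the path is that single edge, which three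
    -- vertices rule out.
    have := hp.length_eq_one_of_mem_edges he
    omega
  · have : (SimpleGraph.Walk.cons hadj w).tail.support = l := by simp [hs]
    refine SimpleGraph.Walk.IsPath.isHamiltonian_of_mem ?_ fun x => ?_
    · rw [SimpleGraph.Walk.isPath_def, this]; exact h1
    · rw [this, ← List.mem_toFinset, h2]; exact mem_univ _

theorem hamOn_univ_of_hasHamiltonCycle [Fintype V] {G : SimpleGraph V} (h : HasHamiltonCycle G) :
    HamOn G univ := by
  obtain ⟨v, p, hp⟩ := h
  have h3 := hp.three_le_length
  have hH := hp.isHamiltonian_tail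
  cases p with
  | nil => simp at h3
  | cons h q =>
    have hq : q.IsPath := ((SimpleGraph.Walk.cons_isCycle_iff q h).1 hp.isCycle).1
    refine ⟨q.support, hq.support_nodup, ?_, ?_, q.isChain_adj_support, ?_⟩
    · ext x
      have := hp.mem_support x
      simp at this ⊢
      rcases this with rfl | h
      · simp
      · exact h
    · simpa using h3
    · intro x hx y hy
      have hx' : q.support.getLast? = some v := by
        rw [List.getLast?_eq_some_getLast (by simp)]; simp
      have hy' := SimpleGraph.Walk.head_support q
      rw [List.head?_eq_some_head (by simp)] at hy
      rw [hx'] at hx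
      simp at hx hy
      subst hx; subst hy
      exact h

theorem hamOn_induce_iff [Fintype V] {G : SimpleGraph V} {S : Finset V} :
    HasHamiltonCycle (G.induce {v | v ∉ S}) ↔ HamOn G Sᶜ := by
  constructor
  · intro h
    obtain ⟨l, h1, h2, h3, h4, h5⟩ := hamOn_univ_of_hasHamiltonCycle h
    refine ⟨l.map (↑), h1.map Subtype.val_injective, ?_, by simpa, ?_, ?_⟩
    · ext x
      have : ∀ y, y ∈ l := fun y => by
        have := Finset.mem_univ y; rw [← h2] at this; simpa using this
      simp [this]
    · rw [List.isChain_map]; exact h4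
    · intro x hx y hy
      simp only [List.getLast?_map, List.head?_map, Option.mem_def, Option.map_eq_some_iff] at hx hy
      obtain ⟨a, ha, rfl⟩ := hx
      obtain ⟨b, hb, rfl⟩ := hy
      exact h5 a ha b hb
  · rintro ⟨l, h1, h2, h3, h4, h5⟩
    have hm : ∀ x ∈ l, x ∈ {v | v ∉ S} := fun x hx => by
      have : x ∈ l.toFinset := by simpa using hx
      rw [h2] at this; simpa using this
    lift l to List {v | v ∉ S} using hm
    apply hasHamiltonCycle_of_hamOn_univ
    refine ⟨l, List.Nodup.of_map _ h1, ?_, by simpa using h3, ?_, ?_⟩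
    · ext x
      have : x.1 ∈ (l.map Subtype.val).toFinset := by
        rw [h2, mem_compl]; exact x.2
      rw [List.mem_toFinset, List.mem_map] at this
      obtain ⟨y, hy, hyx⟩ := this
      rw [Subtype.ext hyx] at hy
      simpa using hy
    · rw [List.isChain_map] at h4; exact h4
    · intro x hx y hy
      refine h5 x ?_ y ?_
      · rw [List.getLast?_map, Option.mem_def, Option.mem_def.1 hx]; rfl
      · rw [List.head?_map, Option.mem_def, Option.mem_def.1 hy]; rfl

theorem isKHamiltonian_iff [Fintype V] {G : SimpleGraph V} {k : ℕ} :
    IsKHamiltonian G k ↔ ∀ S : Finset V, S.card ≤ k → HamOn G Sᶜ := by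
  simp only [IsKHamiltonian, hamOn_induce_iff]

end Cycles

/-! ### Ore's theorem and maximal non-Hamiltonian graphs -/

section OreClosure

variable {V : Type*} [DecidableEq V]

open Classical in
/-- The number of `G`-neighbours of `v` in `T`. -/
noncomputable def degOn (G : SimpleGraph V) (T : Finset V) (v : V) : ℕ := #{u ∈ T | G.Adj v u}

theorem hamOn_of_isClique {G : SimpleGraph V} {T : Finset V} (h3 : 3 ≤ #T)
    (h : ∀ u ∈ T, ∀ v ∈ T, u ≠ v → G.Adj u v) : HamOn G T := by
  have hnd := T.nodup_toList
  refine ⟨T.toList, hnd, by simp, by simpa, ?_, ?_⟩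
  · refine (List.Pairwise.imp_of_mem ?_ hnd).isChain
    intro a b ha hb hab
    exact h a (by simpa using ha) b (by simpa using hb) hab
  · intro x hx y hy
    have hx' := List.mem_of_mem_getLast? hx
    have hy' := List.mem_of_mem_head? hy
    refine h x (by simpa using hx') y (by simpa using hy') ?_
    rintro rfl
    have hl : 3 ≤ T.toList.length := by simpa
    generalize T.toList = l at *
    match l with
    | [] => simp at hl
    | a :: b :: t => grind
    | [a] => simp at hl

/-- Place z directly after w: the old successor of w is a neighbour of w, hence of z. -/
theorem HamOn.insert {G : SimpleGraph V} {T : Finset V} {w z : V} (h : HamOn G T) (hw : w ∈ T)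
    (hz : z ∉ T) (hwz : G.Adj w z) (hN : ∀ u ∈ T, G.Adj w u → G.Adj z u) :
    HamOn G (insert z T) := by
  obtain ⟨l, h1, rfl, h3, h4, h5⟩ := h
  simp only [List.mem_toFinset] at hw hz hN
  obtain ⟨l₁, l₂, rfl⟩ := List.append_of_mem hw
  refine ⟨l₁ ++ w :: z :: l₂, ?_, ?_, ?_, ?_, ?_⟩
  · grind
  · ext; simp; grind
  · simp at h3 ⊢; omega
  · rw [List.isChain_append] at h4 ⊢
    refine ⟨h4.1, ?_, by simpa using h4.2.2⟩
    have h6 := h4.2.1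
    rw [List.isChain_cons_cons]
    refine ⟨hwz, ?_⟩
    cases l₂ with
    | nil => simp
    | cons y t =>
      rw [List.isChain_cons_cons] at h6 ⊢
      exact ⟨hN y (by simp) h6.1, h6.2⟩
  · cases l₂ with
    | nil =>
      cases l₁ with
      | nil => simp at h3
      | cons y t =>
        have h6 := h5 w (by simp [List.getLast?_cons, List.getLast?_append]) y (by simp)
        simp only [List.cons_append, List.getLast?_cons, List.getLast?_append]
        simpa using (hN y (by simp) h6).symm.symm
    | cons y t =>
      simpa [List.getLast?_append, List.head?_append] using h5

/-- If adding the edge `uv` creates a cycle on `T`, there is a path from `u` to `v` on `T`. -/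
theorem exists_path_of_hamOn_sup_edge {G : SimpleGraph V} {T : Finset V} {u v : V}
    (hG : ¬ HamOn G T) (h : HamOn (G ⊔ SimpleGraph.edge u v) T) :
    ∃ l : List V, l.Nodup ∧ l.toFinset = T ∧ 3 ≤ l.length ∧ l.IsChain G.Adj ∧
      ((u ∈ l.head? ∧ v ∈ l.getLast?) ∨ (v ∈ l.head? ∧ u ∈ l.getLast?)) := by
  set H := G ⊔ SimpleGraph.edge u v with hH
  have hadj : ∀ a b, H.Adj a b → G.Adj a b ∨ (a = u ∧ b = v) ∨ (a = v ∧ b = u) := by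
    intro a b hab
    rw [hH, SimpleGraph.sup_adj, SimpleGraph.edge_adj] at hab
    tauto
  -- rotate so that the pair joining the end to the start is not an edge of `G`
  have key : ∃ l : List V, l.Nodup ∧ l.toFinset = T ∧ 3 ≤ l.length ∧ l.IsChain H.Adj ∧
      ∃ x ∈ l.getLast?, ∃ y ∈ l.head?, H.Adj x y ∧ ¬ G.Adj x y := by
    obtain ⟨l, h1, h2, h3, h4, h5⟩ := h
    by_cases hc : l.IsChain G.Adj
    · have : ¬ ∀ x ∈ l.getLast?, ∀ y ∈ l.head?, G.Adj x y := fun h' => hG ⟨l, h1, h2, h3, hc, h'⟩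
      push Not at this
      obtain ⟨x, hx, y, hy, hxy⟩ := this
      exact ⟨l, h1, h2, h3, h4, x, hx, y, hy, h5 x hx y hy, hxy⟩
    · rw [List.isChain_iff_forall_rel_of_append_cons_cons] at hc
      push Not at hc
      obtain ⟨x, y, l₁, l₂, rfl, hxy⟩ := hc
      refine ⟨y :: l₂ ++ (l₁ ++ [x]), ?_, ?_, ?_, ?_, x,
        by simp [List.getLast?_cons, List.getLast?_append], y, by simp, ?_, hxy⟩
      · grind
      · rw [← h2]; ext; simp; tauto
      · simp at h3 ⊢; omega
      · rw [List.isChain_append_cons_cons] at h4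
        refine List.IsChain.append h4.2.2 h4.1 ?_
        intro a ha b hb
        refine h5 a ?_ b ?_
        · simpa [List.getLast?_append] using ha
        · cases l₁ <;> simpa using hb
      · exact (List.isChain_append_cons_cons.1 h4).2.1
  obtain ⟨l, h1, h2, h3, h4, x, hx, y, hy, hxy, hxy'⟩ := key
  have hcase := (hadj x y hxy).resolve_left hxy'
  refine ⟨l, h1, h2, h3, ?_, ?_⟩
  · cases l with
    | nil => simp at h3
    | cons y' t =>
      simp at hy; subst hy
      rcases List.eq_nil_or_concat t with rfl | ⟨m, x', rfl⟩
      · simp at h3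
      · simp [List.getLast?_cons] at hx; subst hx
        have hm : m ≠ [] := by rintro rfl; simp at h3
        -- Only the pair of the two ends can be an edge of `H` outside `G`. The list without its
        -- last entry and the list without its first are therefore chains in `G`, and they overlap
        -- in the nonempty `m`.
        have e : ∀ a b, H.Adj a b → ¬ G.Adj a b → (a = x' ∧ b = y') ∨ (a = y' ∧ b = x') := by
          intro a b hab hab'
          have := (hadj a b hab).resolve_left hab'
          grind
        simp only [List.concat_eq_append] at *
        have p1 : (y' :: m).IsChain G.Adj := by
          have : (y' :: m).IsChain H.Adj := by
            rw [← List.cons_append] at h4; exact h4.left_of_append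
          refine this.imp_of_mem_imp fun a b ha hb hab => ?_
          by_contra hn
          have := e a b hab hn
          grind
        have p2 : (m ++ [x']).IsChain G.Adj := by
          have : (m ++ [x']).IsChain H.Adj := h4.tail
          refine this.imp_of_mem_imp fun a b ha hb hab => ?_
          by_contra hn
          have := e a b hab hn
          grind
        exact List.IsChain.append_overlap (l₁ := [y']) p1 p2 hm
  · rcases hcase with ⟨rfl, rfl⟩ | ⟨rfl, rfl⟩
    · right; exact ⟨hy, hx⟩
    · left; exact ⟨hy, hx⟩

/-- Ore's crossing argument: with a larger degree sum, the pigeonhole principle gives consecutive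
path vertices, the earlier adjacent to v and the later to u, and the path can be rerouted into a
cycle. -/
theorem degOn_add_lt_of_path {G : SimpleGraph V} {T : Finset V} {u v : V} {l : List V}
    (hG : ¬ HamOn G T) (h1 : l.Nodup) (h2 : l.toFinset = T) (h3 : 3 ≤ l.length)
    (h4 : l.IsChain G.Adj) (hu : u ∈ l.head?) (hv : v ∈ l.getLast?) :
    degOn G T u + degOn G T v < #T := by
  classical
  have hT : #T = l.length := by rw [← h2, List.toFinset_card_of_nodup h1]
  have hl0 : l[0] = u := by
    cases l with
    | nil => simp at h3
    | cons a t => simpa using hu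
  have hl1 : l[l.length - 1] = v := by
    rw [List.getLast?_eq_getElem?] at hv
    obtain ⟨_, h⟩ := List.getElem?_eq_some_iff.1 hv
    exact h
  by_contra hcon
  set m := l.length with hm
  -- The default value `u` is never relevant: only indices below `m` are used.
  let f : ℕ → V := fun i => l.getD i u
  have hf : ∀ i, (hi : i < m) → f i = l[i] := fun i hi => List.getD_eq_getElem _ _ hi
  have hinj : ∀ i < m, ∀ j < m, f i = f j → i = j := by
    intro i hi j hj hij
    rw [hf i hi, hf j hj] at hij
    exact (List.Nodup.getElem_inj_iff h1).1 hij
  have hmem : ∀ x ∈ T, ∃ i < m, f i = x := by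
    intro x hx
    rw [← h2, List.mem_toFinset] at hx
    obtain ⟨i, hi, e⟩ := List.getElem_of_mem hx
    exact ⟨i, hi, by rw [hf i hi, e]⟩
  let A := {i ∈ range (m - 1) | G.Adj u (f (i + 1))}
  let B := {i ∈ range (m - 1) | G.Adj v (f i)}
  have hA : degOn G T u ≤ #A := by
    refine (card_le_card (t := A.image fun i => f (i + 1)) ?_).trans card_image_le
    intro x hx
    rw [mem_filter] at hx
    obtain ⟨i, hi, rfl⟩ := hmem x hx.1
    have : i ≠ 0 := by
      rintro rfl
      rw [hf 0 hi, hl0] at hx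
      exact hx.2.ne rfl
    rw [mem_image]
    refine ⟨i - 1, ?_, by rw [Nat.sub_add_cancel (by omega)]⟩
    rw [mem_filter, mem_range, Nat.sub_add_cancel (by omega)]
    exact ⟨by omega, hx.2⟩
  have hB : degOn G T v ≤ #B := by
    refine (card_le_card (t := B.image f) ?_).trans card_image_le
    intro x hx
    rw [mem_filter] at hx
    obtain ⟨i, hi, rfl⟩ := hmem x hx.1
    have : i ≠ m - 1 := by
      rintro rfl
      rw [hf _ hi, hl1] at hx
      exact hx.2.ne rfl
    rw [mem_image]
    refine ⟨i, ?_, rfl⟩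
    rw [mem_filter, mem_range]
    exact ⟨by omega, hx.2⟩
  have hAB : ¬ Disjoint A B := by
    intro hd
    have : #(A ∪ B) ≤ #(range (m - 1)) :=
      card_le_card (union_subset (filter_subset _ _) (filter_subset _ _))
    rw [card_union_of_disjoint hd, card_range] at this
    omega
  rw [not_disjoint_iff] at hAB
  obtain ⟨i, hiA, hiB⟩ := hAB
  simp only [A, B, mem_filter, mem_range] at hiA hiB
  have hi : i + 1 < m := by omega
  rw [hf _ hi] at hiA
  rw [hf _ (by omega)] at hiB
  apply hG
  have hsplit : l = l.take (i + 1) ++ l.drop (i + 1) := (List.take_append_drop _ _).symm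
  have hlast : (l.take (i + 1)).getLast? = some l[i] := by
    rw [List.getLast?_take]; simp
  have hhead : (l.drop (i + 1)).head? = some l[i + 1] := by
    rw [List.head?_drop]; simp
  have hhead' : (l.take (i + 1)).head? = l.head? := by
    rw [List.head?_take]; simp
  have hlast' : (l.drop (i + 1)).getLast? = l.getLast? := by
    rw [List.getLast?_drop]; simp; omega
  have hperm : (l.take (i + 1) ++ (l.drop (i + 1)).reverse).Perm l := by
    conv_rhs => rw [hsplit]
    exact (List.reverse_perm _).append_left _
  -- The cycle runs from u to position i, jumps to v, returns along the path to position i + 1, and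
  -- closes at u.
  refine ⟨l.take (i + 1) ++ (l.drop (i + 1)).reverse, hperm.nodup_iff.2 h1, ?_, ?_, ?_, ?_⟩
  · rw [← h2]; exact List.toFinset_eq_of_perm _ _ hperm
  · rw [hperm.length_eq]; exact h3
  · refine List.IsChain.append (h4.take _) ?_ ?_
    · rw [List.isChain_reverse]
      exact (h4.drop _).imp fun _ _ h => h.symm
    · intro x hx y hy
      rw [hlast] at hx
      rw [List.head?_reverse, hlast'] at hy
      simp at hx; subst hx
      have : y = v := by rw [Option.mem_def] at hy hv; rw [hy] at hv; simpa using hv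
      subst this
      exact hiB.2.symm
  · intro x hx y hy
    rw [List.getLast?_append, List.getLast?_reverse, hhead] at hx
    rw [List.head?_append, hhead', Option.mem_def.1 hu] at hy
    simp at hx hy
    subst hx; subst hy
    exact hiA.2.symm

/-- Ore's degree condition, for one missing edge. -/
theorem degOn_add_lt_of_hamOn_sup_edge {G : SimpleGraph V} {T : Finset V} {u v : V}
    (hG : ¬ HamOn G T) (h : HamOn (G ⊔ SimpleGraph.edge u v) T) :
    degOn G T u + degOn G T v < #T := by
  obtain ⟨l, h1, h2, h3, h4, ⟨hu, hv⟩ | ⟨hv, hu⟩⟩ := exists_path_of_hamOn_sup_edge hG h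
  · exact degOn_add_lt_of_path hG h1 h2 h3 h4 hu hv
  · rw [add_comm]; exact degOn_add_lt_of_path hG h1 h2 h3 h4 hv hu

/-- A graph without a cycle on `T` extends to one that satisfies the negation of Ore's condition
at every missing edge. -/
theorem exists_ore_closed [Fintype V] {G : SimpleGraph V} {T : Finset V} (hG : ¬ HamOn G T) :
    ∃ C : SimpleGraph V, G ≤ C ∧ ¬ HamOn C T ∧
      ∀ u v, u ≠ v → #T ≤ degOn C T u + degOn C T v → C.Adj u v := by
  -- A maximal graph without a cycle on `T` replaces the iterated closure.
  obtain ⟨C, hGC, hC⟩ := (Set.toFinite {C : SimpleGraph V | ¬ HamOn C T}).exists_le_maximal hG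
  refine ⟨C, hGC, hC.prop, fun u v huv hd => ?_⟩
  by_contra hn
  have hlt : C < C ⊔ SimpleGraph.edge u v := by
    refine lt_of_le_of_ne le_sup_left fun he => hn ?_
    rw [he, SimpleGraph.sup_adj, SimpleGraph.edge_adj]
    tauto
  have : HamOn (C ⊔ SimpleGraph.edge u v) T := by
    by_contra h
    exact hlt.not_ge (hC.2 h hlt.le)
  have := degOn_add_lt_of_hamOn_sup_edge hC.prop this
  omega

end OreClosure

/-! ### Structure of Ore-closed graphs with few missing edges -/

section Structure

variable {V : Type*} [DecidableEq V]

open Classical in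
/-- The number of vertices of `T`, other than `v`, that are not `G`-neighbours of `v`. -/
noncomputable def codegOn (G : SimpleGraph V) (T : Finset V) (v : V) : ℕ :=
  #{u ∈ T | u ≠ v ∧ ¬ G.Adj v u}

theorem degOn_add_codegOn {G : SimpleGraph V} {T : Finset V} {v : V} (hv : v ∈ T) :
    degOn G T v + codegOn G T v + 1 = #T := by
  classical
  have h1 : #{u ∈ T | G.Adj v u} + #{u ∈ T | ¬ G.Adj v u} = #T :=
    card_filter_add_card_filter_not _
  have h2 : {u ∈ T | ¬ G.Adj v u} = insert v {u ∈ T | u ≠ v ∧ ¬ G.Adj v u} := by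
    ext u
    simp only [mem_filter, mem_insert]
    by_cases h : u = v
    · subst h; simp [hv]
    · simp [h]
  rw [h2, card_insert_of_notMem (by simp)] at h1
  unfold degOn codegOn
  omega

omit [DecidableEq V] in
theorem card_le_degOn {G : SimpleGraph V} {T A : Finset V} {v : V} (hA : A ⊆ T)
    (h : ∀ u ∈ A, G.Adj v u) : #A ≤ degOn G T v := by
  classical
  exact card_le_card fun u hu => mem_filter.2 ⟨hA hu, h u hu⟩

/-- In an Ore-closed graph with few missing edges, the vertices of small degree are few, have very
small degree, and the others form a clique. -/
theorem exists_low_part {C : SimpleGraph V} {T : Finset V} {s k : ℕ} (hs : 1 ≤ s)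
    (hore : ∀ u v, u ≠ v → #T ≤ degOn C T u + degOn C T v → C.Adj u v)
    (hmiss : ∑ v ∈ T, codegOn C T v ≤ 2 * s * (#T + k)) (hm : 10 * s + 4 * k + 6 ≤ #T) :
    ∃ X ⊆ T, #X < 5 * s ∧ (∀ x ∈ X, degOn C T x < 5 * s) ∧
      ∀ u ∈ T \ X, ∀ v ∈ T \ X, u ≠ v → C.Adj u v := by
  set X := {v ∈ T | 2 * degOn C T v < #T} with hX
  have hXT : X ⊆ T := filter_subset _ _
  have hB : ∀ v ∈ T \ X, #T ≤ 2 * degOn C T v := by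
    intro v hv
    simp only [hX, mem_sdiff, mem_filter, not_and, not_lt] at hv
    exact hv.2 hv.1
  have hcl : ∀ u ∈ T \ X, ∀ v ∈ T \ X, u ≠ v → C.Adj u v := by
    intro u hu v hv huv
    have := hB u hu
    have := hB v hv
    exact hore u v huv (by omega)
  -- Each low vertex has codegree at least (#T - 1)/2, so 5s of them would give 5(#T - 1) ≤ 4(#T +
  -- k), false for large #T.
  have hcard : #X < 5 * s := by
    by_contra hcon
    push Not at hcon
    have h1 : #X * (#T - 1) ≤ ∑ v ∈ X, 2 * codegOn C T v := by
      rw [← smul_eq_mul]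
      refine card_nsmul_le_sum _ _ _ fun v hv => ?_
      have := degOn_add_codegOn (G := C) (hXT hv)
      have := (mem_filter.1 hv).2
      omega
    have h2 : ∑ v ∈ X, 2 * codegOn C T v ≤ ∑ v ∈ T, 2 * codegOn C T v :=
      sum_le_sum_of_subset hXT
    rw [← mul_sum, ← mul_sum] at h2
    rw [← mul_sum] at h1
    have h3 : 5 * s * (#T - 1) ≤ #X * (#T - 1) := Nat.mul_le_mul_right _ hcon
    obtain ⟨t, ht⟩ : ∃ t, #T = t + 1 := ⟨#T - 1, by omega⟩
    rw [ht, Nat.add_sub_cancel] at h1 h3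
    rw [ht] at hmiss hm
    have h4 : s * (4 * k + 5) ≤ s * t := Nat.mul_le_mul_left _ (by omega)
    nlinarith
  refine ⟨X, hXT, hcard, fun x hx => ?_, hcl⟩
  by_contra hcon
  push Not at hcon
  have hcB : #(T \ X) + #X = #T := card_sdiff_add_card_eq_card hXT
  have hxB : x ∉ T \ X := fun h => (mem_sdiff.1 h).2 hx
  -- A low vertex of degree at least 5s would satisfy Ore's condition with every clique vertex, and
  -- then would not be low.
  have : #(T \ X) ≤ degOn C T x := by
    refine card_le_degOn sdiff_subset fun b hb => ?_
    refine hore x b (fun h => hxB (h ▸ hb)) ?_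
    have h1 : #((T \ X).erase b) ≤ degOn C T b :=
      card_le_degOn ((erase_subset _ _).trans sdiff_subset) fun u hu =>
        hcl b hb u (mem_of_mem_erase hu) (ne_of_mem_erase hu).symm
    rw [card_erase_of_mem hb] at h1
    omega
  have := (mem_filter.1 hx).2
  omega

/-- Nonadjacent pairs between X and the rest are counted from both ends, so each low vertex costs
about 2#T in the codegree sum. The budget of about 2s#T does not pay for s + 1 of them. -/
theorem card_low_part_le {C : SimpleGraph V} {T X : Finset V} {s k : ℕ} (hXT : X ⊆ T)
    (hX : #X < 5 * s) (hdX : ∀ x ∈ X, degOn C T x < 5 * s)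
    (hmiss : ∑ v ∈ T, codegOn C T v ≤ 2 * s * (#T + k))
    (hm : (s + 1) * (15 * s) + 2 * s * k < #T) : #X ≤ s := by
  classical
  by_contra hcon
  push Not at hcon
  have hcB : #(T \ X) + #X = #T := card_sdiff_add_card_eq_card hXT
  have h1 : #X * (#T - 5 * s) ≤ ∑ x ∈ X, codegOn C T x := by
    rw [← smul_eq_mul]
    refine card_nsmul_le_sum _ _ _ fun v hv => ?_
    have := degOn_add_codegOn (G := C) (hXT hv)
    have := hdX v hv
    omega
  have h2 : #X * (#(T \ X) - 5 * s) ≤ ∑ x ∈ X, #{b ∈ T \ X | ¬ C.Adj x b} := by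
    rw [← smul_eq_mul]
    refine card_nsmul_le_sum _ _ _ fun v hv => ?_
    have h3 : #{b ∈ T \ X | C.Adj v b} + #{b ∈ T \ X | ¬ C.Adj v b} = #(T \ X) :=
      card_filter_add_card_filter_not _
    have h4 : #{b ∈ T \ X | C.Adj v b} ≤ degOn C T v :=
      card_le_card (filter_subset_filter _ sdiff_subset)
    have := hdX v hv
    omega
  have h3 : ∑ x ∈ X, #{b ∈ T \ X | ¬ C.Adj x b} = ∑ b ∈ T \ X, #{x ∈ X | ¬ C.Adj x b} :=
    sum_card_bipartiteAbove_eq_sum_card_bipartiteBelow _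
  have h4 : ∑ b ∈ T \ X, #{x ∈ X | ¬ C.Adj x b} ≤ ∑ b ∈ T \ X, codegOn C T b := by
    refine sum_le_sum fun b hb => card_le_card fun x hx => ?_
    rw [mem_filter] at hx ⊢
    rw [mem_sdiff] at hb
    exact ⟨hXT hx.1, fun h => hb.2 (h ▸ hx.1), fun h => hx.2 h.symm⟩
  have h5 : ∑ b ∈ T \ X, codegOn C T b + ∑ x ∈ X, codegOn C T x = ∑ v ∈ T, codegOn C T v :=
    sum_sdiff hXT
  have h6 : #X * (#T - 5 * s) + #X * (#(T \ X) - 5 * s) ≤ 2 * s * (#T + k) := by omega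
  have h7 : (s + 1) * ((#T - 5 * s) + (#(T \ X) - 5 * s)) ≤ 2 * s * (#T + k) := by
    rw [← mul_add] at h6
    exact (Nat.mul_le_mul_right _ hcon).trans h6
  have hs : 15 * s ≤ #T := by nlinarith
  obtain ⟨t, ht⟩ : ∃ t, #T = t + 15 * s := ⟨#T - 15 * s, by omega⟩
  have h8 : 2 * t + 15 * s ≤ (#T - 5 * s) + (#(T \ X) - 5 * s) := by omega
  have h9 := (Nat.mul_le_mul_left (s + 1) h8).trans h7
  rw [ht] at h9 hm
  nlinarith

/-- Blowing up one vertex of a cycle to a clique of vertices with at least the same neighbours. -/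
theorem HamOn.union {C : SimpleGraph V} {F Z : Finset V} {w : V} (h : HamOn C F) (hw : w ∈ F)
    (hFZ : Disjoint F Z) (hwZ : ∀ z ∈ Z, C.Adj w z)
    (hN : ∀ z ∈ Z, ∀ u ∈ F ∪ Z, u ≠ z → C.Adj w u → C.Adj z u) : HamOn C (F ∪ Z) := by
  induction Z using Finset.induction_on with
  | empty => simpa
  | insert z Z hz ih =>
    rw [disjoint_insert_right] at hFZ
    have h1 : HamOn C (F ∪ Z) := ih hFZ.2 (fun z hz => hwZ z (mem_insert_of_mem hz))
      fun z' hz' u hu => hN z' (mem_insert_of_mem hz') u (by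
        simp only [mem_union, mem_insert] at hu ⊢; tauto)
    rw [union_insert]
    have hz' : z ∉ F ∪ Z := by simp [hz, hFZ.1]
    refine h1.insert (mem_union_left _ hw) hz' (hwZ z (mem_insert_self _ _)) fun u hu => ?_
    refine hN z (mem_insert_self _ _) u ?_ (fun h => hz' (h ▸ hu))
    simp only [mem_union, mem_insert] at hu ⊢; tauto

/-- The core of the structure theorem: the intermediate attachment numbers give a cycle. -/
theorem hamOn_of_attachment [Fintype V] {C : SimpleGraph V} {X Y : Finset V} {w : V} {s : ℕ}
    (hXY : Disjoint X Y) (hwX : w ∉ X) (hwY : w ∉ Y) (hX : #X = s) (hY : 2 ≤ #Y) (hYs : #Y < s)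
    (hYX : ∀ x ∈ X, ∀ y ∈ Y, C.Adj x y) (hYY : ∀ u ∈ Y, ∀ v ∈ Y, u ≠ v → C.Adj u v)
    (hwa : ∀ y ∈ Y, C.Adj w y) (hdeg : ∀ x ∈ X, s ≤ degOn C (X ∪ Y) x) :
    HamOn C (insert w (X ∪ Y)) := by
  classical
  set F := insert w (X ∪ Y) with hF
  have hcF : #F = s + #Y + 1 := by
    rw [hF, card_insert_of_notMem (by simp [hwX, hwY]), card_union_of_disjoint hXY, hX]
  by_contra hcon
  obtain ⟨D, hCD, hD, hore⟩ := exists_ore_closed hcon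
  refine hD (hamOn_of_isClique (by omega) ?_)
  -- Two vertices of X have degree sum at least 2s ≥ s + #Y + 1, because #Y < s.
  have hXX : ∀ u ∈ X, ∀ v ∈ X, u ≠ v → D.Adj u v := by
    have : ∀ x ∈ X, s ≤ degOn D F x := fun x hx => (hdeg x hx).trans <| by
      refine card_le_card fun u hu => ?_
      rw [mem_filter] at hu ⊢
      exact ⟨mem_insert_of_mem hu.1, hCD hu.2⟩
    intro u hu v hv huv
    refine hore u v huv ?_
    have h1 := this u hu
    have h2 := this v hv
    omega
  have hXYD : ∀ u ∈ X ∪ Y, ∀ v ∈ X ∪ Y, u ≠ v → D.Adj u v := by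
    intro u hu v hv huv
    rw [mem_union] at hu hv
    rcases hu with hu | hu <;> rcases hv with hv | hv
    · exact hXX u hu v hv huv
    · exact hCD (hYX u hu v hv)
    · exact hCD (hYX v hv u hu).symm
    · exact hCD (hYY u hu v hv huv)
  -- Here #Y ≥ 2 is needed: the degree sum is at least #Y + (s + #Y - 1) ≥ s + #Y + 1.
  have hw : ∀ x ∈ X ∪ Y, D.Adj w x := by
    intro x hx
    have hne : w ≠ x := by rintro rfl; simp [hwX, hwY] at hx
    refine hore w x hne ?_
    have h1 : #Y ≤ degOn D F w :=
      card_le_degOn (subset_union_right.trans (subset_insert _ _)) fun y hy => hCD (hwa y hy)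
    have h2 : #((X ∪ Y).erase x) ≤ degOn D F x :=
      card_le_degOn ((erase_subset _ _).trans (subset_insert _ _)) fun u hu =>
        hXYD x hx u (mem_of_mem_erase hu) (ne_of_mem_erase hu).symm
    rw [card_erase_of_mem hx, card_union_of_disjoint hXY, hX] at h2
    omega
  intro u hu v hv huv
  rw [hF, mem_insert] at hu hv
  rcases hu with rfl | hu <;> rcases hv with rfl | hv
  · exact absurd rfl huv
  · exact hw v hv
  · exact (hw u hu).symm
  · exact hXYD u hu v hv huv

/-- Structure of Ore-closed graphs of minimum degree at least `s` on `T` that miss few edges and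
have no cycle on `T`. -/
theorem structure_of_not_hamOn [Fintype V] {C : SimpleGraph V} {T : Finset V} {s k : ℕ}
    (hs : 2 ≤ s) (hC : ¬ HamOn C T)
    (hore : ∀ u v, u ≠ v → #T ≤ degOn C T u + degOn C T v → C.Adj u v)
    (hdeg : ∀ v ∈ T, s ≤ degOn C T v)
    (hmiss : ∑ v ∈ T, codegOn C T v ≤ 2 * s * (#T + k))
    (hm : 10 * s + 4 * k + 6 + (s + 1) * (15 * s) + 2 * s * k ≤ #T) :
    ∃ X Y : Finset V, X ⊆ T ∧ Y ⊆ T ∧ Disjoint X Y ∧ #X = s ∧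
      (∀ x ∈ X, degOn C T x = s) ∧
      (∀ x ∈ X, ∀ v ∈ T \ X, C.Adj x v ↔ v ∈ Y) ∧
      ((#Y = 1 ∧ ∀ u ∈ X, ∀ v ∈ X, u ≠ v → C.Adj u v) ∨
        (#Y = s ∧ ∀ u ∈ X, ∀ v ∈ X, ¬ C.Adj u v)) := by
  classical
  obtain ⟨X, hXT, hX5, hdX, hcl⟩ := exists_low_part (by omega) hore hmiss (by omega)
  have hXs : #X ≤ s := card_low_part_le hXT hX5 hdX hmiss (by omega)
  set B := T \ X with hB
  have hcB : #B + #X = #T := card_sdiff_add_card_eq_card hXT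
  have hBT : B ⊆ T := sdiff_subset
  have hXB : Disjoint X B := disjoint_sdiff
  have hTXB : ∀ v ∈ T, v ∈ X ∨ v ∈ B := fun v hv => by
    by_cases h : v ∈ X
    · exact Or.inl h
    · exact Or.inr (mem_sdiff.2 ⟨hv, h⟩)
  have hdB : ∀ b ∈ B, #(B.erase b) ≤ degOn C T b := fun b hb =>
    card_le_degOn ((erase_subset _ _).trans hBT) fun u hu =>
      hcl b hb u (mem_of_mem_erase hu) (ne_of_mem_erase hu).symm
  have hXne : X.Nonempty := by
    rw [nonempty_iff_ne_empty]
    rintro rfl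
    refine hC (hamOn_of_isClique (by omega) ?_)
    simpa [hB] using hcl
  -- A clique vertex b not adjacent to x has degree at least #B - 1, so failure of Ore's condition
  -- caps the degree of x at #T - #B = #X.
  have hdXle : ∀ x ∈ X, degOn C T x ≤ #X := by
    intro x hx
    obtain ⟨b, hb, hxb⟩ : ∃ b ∈ B, ¬ C.Adj x b := by
      by_contra hcon
      push Not at hcon
      have := card_le_degOn hBT hcon
      have := hdX x hx
      omega
    have h1 : ¬ #T ≤ degOn C T x + degOn C T b := fun h =>
      hxb (hore x b (fun h => disjoint_left.1 hXB hx (h ▸ hb)) h)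
    have h2 := hdB b hb
    rw [card_erase_of_mem hb] at h2
    omega
  have hXcard : #X = s := by
    obtain ⟨x, hx⟩ := hXne
    have := hdXle x hx
    have := hdeg x (hXT hx)
    omega
  have hdXeq : ∀ x ∈ X, degOn C T x = s := fun x hx => by
    have := hdXle x hx
    have := hdeg x (hXT hx)
    omega
  set Y := {b ∈ B | ∃ x ∈ X, C.Adj x b} with hY
  have hYB : Y ⊆ B := filter_subset _ _
  have hXY : Disjoint X Y := hXB.mono_right hYB
  have hYX : ∀ x ∈ X, ∀ y ∈ Y, C.Adj x y := by
    intro x hx y hy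
    obtain ⟨hyB, x', hx', hxy⟩ := mem_filter.1 hy
    refine hore x y (fun h => disjoint_left.1 hXY hx (h ▸ hy)) ?_
    -- One neighbour in X raises the degree of y to at least #B, just enough for Ore's condition
    -- with every vertex of X.
    have h1 : #(insert x' (B.erase y)) ≤ degOn C T y := by
      refine card_le_degOn (insert_subset (hXT hx') ((erase_subset _ _).trans hBT)) fun u hu => ?_
      rw [mem_insert] at hu
      rcases hu with rfl | hu
      · exact hxy.symm
      · exact hcl y hyB u (mem_of_mem_erase hu) (ne_of_mem_erase hu).symm
    rw [card_insert_of_notMem, card_erase_of_mem hyB] at h1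
    · have := hdXeq x hx
      omega
    · exact fun h => disjoint_left.1 hXB hx' (mem_of_mem_erase h)
  have hiff : ∀ x ∈ X, ∀ v ∈ T \ X, C.Adj x v ↔ v ∈ Y := fun x hx v hv =>
    ⟨fun h => mem_filter.2 ⟨hv, x, hx, h⟩, fun h => hYX x hx v h⟩
  have hdsplit : ∀ x ∈ X, degOn C X x + #Y = s := by
    intro x hx
    rw [← hdXeq x hx]
    unfold degOn
    rw [← card_union_of_disjoint (hXY.mono_left (filter_subset _ _))]
    congr 1
    ext v
    simp only [mem_union, mem_filter]
    constructor
    · rintro (⟨h1, h2⟩ | h)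
      · exact ⟨hXT h1, h2⟩
      · exact ⟨hBT (hYB h), hYX x hx v h⟩
    · rintro ⟨h1, h2⟩
      rcases hTXB v h1 with h | h
      · exact Or.inl ⟨h, h2⟩
      · exact Or.inr ((hiff x hx v h).1 h2)
  refine ⟨X, Y, hXT, hYB.trans hBT, hXY, hXcard, hdXeq, hiff, ?_⟩
  obtain ⟨x₀, hx₀⟩ := hXne
  have hlt : ∀ x ∈ X, degOn C X x + codegOn C X x + 1 = s := fun x hx => by
    rw [degOn_add_codegOn hx, hXcard]
  have h0 := hdsplit x₀ hx₀
  have h0' := hlt x₀ hx₀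
  rcases Nat.lt_or_ge 1 #Y with h1 | h1
  · rcases Nat.lt_or_ge #Y s with h2 | h2
    · exfalso
      -- A cycle on X, Y and one vertex w extends to `T`: the neighbours of w in `T` lie in the
      -- clique `B`, so the remaining vertices of `B \ Y` can be inserted as copies of w.
      obtain ⟨w, hw⟩ : (B \ Y).Nonempty := by
        rw [← card_pos]
        have : #(B \ Y) + #Y = #B := card_sdiff_add_card_eq_card hYB
        omega
      have hwB := (mem_sdiff.1 hw).1
      have hwY := (mem_sdiff.1 hw).2
      have hwX : w ∉ X := fun h => disjoint_left.1 hXB h hwB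
      have hF := hamOn_of_attachment hXY hwX hwY hXcard h1 h2 hYX
        (fun u hu v hv => hcl u (hYB hu) v (hYB hv))
        (fun y hy => hcl w hwB y (hYB hy) fun h => hwY (h ▸ hy))
        (fun x hx => by
          rw [← hdXeq x hx]
          refine card_le_card fun u hu => ?_
          rw [mem_filter] at hu ⊢
          refine ⟨?_, hu.2⟩
          rw [mem_union]
          rcases hTXB u hu.1 with h | h
          · exact Or.inl h
          · exact Or.inr ((hiff x hx u h).1 hu.2))
      have hwN : ∀ u ∈ T, C.Adj w u → u ∈ B := by
        intro u hu hwu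
        rcases hTXB u hu with h | h
        · exact absurd ((hiff u h w hwB).1 hwu.symm) hwY
        · exact h
      have hT : T = insert w (X ∪ Y) ∪ (B \ Y).erase w := by
        ext v
        simp only [mem_union, mem_insert, mem_erase, mem_sdiff]
        constructor
        · intro hv
          rcases hTXB v hv with h | h <;> tauto
        · rintro ((rfl | h | h) | h)
          · exact hBT hwB
          · exact hXT h
          · exact hBT (hYB h)
          · exact hBT h.2.1
      refine hC ?_
      rw [hT]
      refine hF.union (mem_insert_self _ _) ?_ ?_ ?_
      · rw [disjoint_left]
        intro v hv hv'
        simp only [mem_union, mem_insert, mem_erase, mem_sdiff] at hv hv'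
        rcases hv with h | h | h
        · exact hv'.1 h
        · exact disjoint_left.1 hXB h hv'.2.1
        · exact hv'.2.2 h
      · intro z hz
        simp only [mem_erase, mem_sdiff] at hz
        exact hcl w hwB z hz.2.1 (Ne.symm hz.1)
      · intro z hz u hu huz hwu
        rw [← hT] at hu
        simp only [mem_erase, mem_sdiff] at hz
        exact hcl z hz.2.1 u (hwN u hu hwu) huz.symm
    · right
      refine ⟨by omega, fun u hu v hv huv => ?_⟩
      have h3 : degOn C X u = 0 := by have := hdsplit u hu; omega
      rw [degOn, card_eq_zero, filter_eq_empty_iff] at h3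
      exact h3 hv huv
  · left
    have hY1 : #Y = 1 := by omega
    refine ⟨hY1, fun u hu v hv huv => ?_⟩
    have h3 : codegOn C X u = 0 := by
      have := hdsplit u hu
      have := hlt u hu
      omega
    rw [codegOn, card_eq_zero, filter_eq_empty_iff] at h3
    by_contra h
    exact h3 hv ⟨huv.symm, h⟩

end Structure

/-! ### Spectral radius and missing edges -/

section Spectral

variable {V : Type*} [Fintype V] [DecidableEq V]

/-- A Collatz–Wielandt bound for the signless Laplacian. -/
theorem exists_q_mul_le [Nonempty V] (G : SimpleGraph V) [DecidableRel G.Adj] {w : V → ℝ}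
    (hw : ∀ v, 0 < w v) : ∃ v, q G * w v ≤ G.degree v * w v + ∑ u ∈ G.neighborFinset v, w u := by
  obtain ⟨x, hx⟩ := (q_isGreatest G).1.exists_hasEigenvector
  have hx0 : x ≠ 0 := hx.2
  have hxe : ∀ v, G.degree v * x v + ∑ u ∈ G.neighborFinset v, x u = q G * x v := by
    intro v
    have := congrFun hx.apply_eq_smul v
    rw [Matrix.toLin'_apply, signlessLaplacian, Matrix.add_mulVec, Pi.add_apply,
      SimpleGraph.adjMatrix_mulVec_apply, SimpleGraph.degMatrix, Matrix.mulVec_diagonal] at this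
    simpa using this
  -- At the vertex maximising |x v| / w v, the eigenvector equation can be compared termwise with
  -- the weights.
  obtain ⟨v, -, hv⟩ := exists_max_image univ (fun v => |x v| / w v) univ_nonempty
  set r := |x v| / w v with hr
  have hle : ∀ u, |x u| ≤ r * w u := fun u => by
    have := hv u (mem_univ _)
    rwa [div_le_iff₀ (hw u)] at this
  have hr0 : 0 < r := by
    obtain ⟨u, hu⟩ : ∃ u, x u ≠ 0 := Function.ne_iff.1 hx0
    have h1 := hle u
    have h2 := abs_pos.2 hu
    by_contra hcon
    nlinarith [hw u]
  have hxv : |x v| = r * w v := by rw [hr, div_mul_cancel₀ _ (hw v).ne']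
  refine ⟨v, le_of_mul_le_mul_left ?_ hr0⟩
  calc r * (q G * w v) = q G * |x v| := by rw [hxv]; ring
    _ ≤ |q G * x v| := by
      rw [abs_mul]; exact mul_le_mul_of_nonneg_right (le_abs_self _) (abs_nonneg _)
    _ = |G.degree v * x v + ∑ u ∈ G.neighborFinset v, x u| := by rw [hxe]
    _ ≤ |G.degree v * x v| + |∑ u ∈ G.neighborFinset v, x u| := abs_add_le _ _
    _ ≤ G.degree v * |x v| + ∑ u ∈ G.neighborFinset v, |x u| := by
      rw [abs_mul, Nat.abs_cast]
      gcongr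
      exact abs_sum_le_sum_abs _ _
    _ ≤ G.degree v * (r * w v) + ∑ u ∈ G.neighborFinset v, r * w u := by
      gcongr <;> exact hle _
    _ = _ := by rw [← mul_sum]; ring

/-- A large signless Laplacian spectral radius forces many edges. -/
theorem le_sum_degree_of_le_q (G : SimpleGraph V) [DecidableRel G.Adj] [Nonempty V]
    (hd : ∀ v, 0 < G.degree v) {s : ℝ}
    (hq : 2 * ((Fintype.card V : ℝ) - s - 1) ≤ q G) :
    (Fintype.card V : ℝ) * (Fintype.card V - 1) - 2 * s * Fintype.card V ≤
      ∑ v, (G.degree v : ℝ) := by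
  obtain ⟨v, hv⟩ := exists_q_mul_le G (w := fun v => (G.degree v : ℝ))
    fun v => by exact_mod_cast hd v
  have hdv : (0 : ℝ) < G.degree v := by exact_mod_cast hd v
  have hle : ∀ u, (G.degree u : ℝ) ≤ Fintype.card V - 1 := fun u => by
    have := G.degree_lt_card_verts u
    have : ((G.degree u + 1 : ℕ) : ℝ) ≤ Fintype.card V := by exact_mod_cast this
    push_cast at this; linarith
  have h1 : ∑ u ∈ G.neighborFinset v, (G.degree u : ℝ) ≤ G.degree v * (Fintype.card V - 1) := by
    have := sum_le_card_nsmul (G.neighborFinset v) (fun u => (G.degree u : ℝ)) _ fun u _ => hle u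
    rwa [SimpleGraph.card_neighborFinset_eq_degree, nsmul_eq_mul] at this
  have h2 : (G.degree v : ℝ) + ∑ u ∈ G.neighborFinset v, (G.degree u : ℝ) ≤
      ∑ u, (G.degree u : ℝ) := by
    rw [← sum_insert (a := v) (f := fun u => (G.degree u : ℝ)) (by simp)]
    exact sum_le_sum_of_subset_of_nonneg (subset_univ _) fun _ _ _ => Nat.cast_nonneg _
  have hn := hle v
  set n : ℝ := (Fintype.card V : ℝ)
  set d : ℝ := (G.degree v : ℝ)
  have h3 : n - 1 - 2 * s ≤ d := by
    have : q G * d ≤ (d + (n - 1)) * d := by linarith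
    have := le_of_mul_le_mul_right this hdv
    linarith
  have h4 : 2 * (n - s - 1) * d ≤ q G * d := mul_le_mul_of_nonneg_right hq hdv.le
  -- The lower bound d(2(n - s - 1) - d + 1) for the degree sum is concave in d, and d lies between
  -- n - 1 - 2s and n - 1.
  nlinarith [mul_nonneg (sub_nonneg.2 hn) (sub_nonneg.2 h3)]

/-- The graph of the edges that are missing from `G` outside `X`. -/
def missing (G : SimpleGraph V) (X : Finset V) : SimpleGraph V where
  Adj u v := u ≠ v ∧ u ∉ X ∧ v ∉ X ∧ ¬ G.Adj u v
  symm := ⟨fun _ _ h => ⟨h.1.symm, h.2.2.1, h.2.1, fun e => h.2.2.2 e.symm⟩⟩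
  loopless := ⟨fun _ h => h.1 rfl⟩

instance (G : SimpleGraph V) [DecidableRel G.Adj] (X : Finset V) :
    DecidableRel (missing G X).Adj :=
  fun u v => inferInstanceAs (Decidable (u ≠ v ∧ u ∉ X ∧ v ∉ X ∧ ¬ G.Adj u v))

/-- The neighbours of v outside X, v itself and its missing neighbours partition the complement of
X; vertices of Y also see all of X. Constant weight 1 gives a degree formula. -/
theorem sum_neighborFinset_add {G : SimpleGraph V} [DecidableRel G.Adj] {X Y : Finset V}
    (hXY : ∀ x ∈ X, ∀ v, v ∉ X → (G.Adj x v ↔ v ∈ Y)) (w : V → ℝ) {v : V} (hv : v ∉ X) :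
    ∑ u ∈ G.neighborFinset v, w u + w v + ∑ u ∈ (missing G X).neighborFinset v, w u =
      ∑ u ∈ Xᶜ, w u + if v ∈ Y then ∑ u ∈ X, w u else 0 := by
  have h1 : ∀ (H : SimpleGraph V) [DecidableRel H.Adj], ∑ u ∈ H.neighborFinset v, w u =
      ∑ u, if H.Adj v u then w u else 0 := by
    intro H _
    rw [SimpleGraph.neighborFinset_eq_filter, sum_filter]
  have h2 : w v = ∑ u, if u = v then w u else 0 := by simp
  have h3 : (if v ∈ Y then ∑ u ∈ X, w u else 0) =
      ∑ u, if u ∈ X then (if v ∈ Y then w u else 0) else 0 := by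
    rw [← sum_filter, filter_univ_mem]; split_ifs <;> simp
  have h4 : ∑ u ∈ Xᶜ, w u = ∑ u, if u ∉ X then w u else 0 := by
    rw [← sum_filter]; congr 1; ext; simp
  rw [h1, h1, h3, h4]
  rw [h2]
  rw [← sum_add_distrib, ← sum_add_distrib, ← sum_add_distrib]
  refine sum_congr rfl fun u _ => ?_
  have h5 : (missing G X).Adj v u ↔ v ≠ u ∧ v ∉ X ∧ u ∉ X ∧ ¬ G.Adj v u := Iff.rfl
  by_cases huX : u ∈ X
  · have h6 : G.Adj v u ↔ v ∈ Y := by rw [G.adj_comm]; exact hXY u huX v hv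
    have h7 : u ≠ v := fun h => hv (h ▸ huX)
    simp [h5, h6, huX, h7]
  · by_cases huv : u = v
    · subst huv; simp [huX]
    · by_cases h : G.Adj v u <;> simp [h5, huX, huv, h, hv, Ne.symm huv]

/-- The left side is the value of Qw - 2(M - 1)w at a vertex outside X, with S the total weight
outside X and E the weight of the missing neighbours. The orders M³ and M² cancel. At order M, the
term -B(a + e) dominates the errors when a + e > 0, and sy - 4c ≤ -1 decides when a = e = 0. -/
theorem weight_bound {M K B y a e c s : ℝ} (ha : 0 ≤ a) (he : 0 ≤ e)
    (hK : a + 2 * e ≤ K) (hB : B = 2 * K + y + 1) (hy : 0 ≤ y) (hM : 2 * (B * K) ≤ M)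
    (hM' : B * (s * y + 2 * c) < M) (hc : s * y + 1 ≤ 4 * c) (S E : ℝ)
    (hS : S = M ^ 3 + M * (s * y - 4 * c) + B * (s * y + 2 * c)) (hE : e * (M ^ 2 - M * K) ≤ E) :
    (-M + a - e) * (M ^ 2 + M * (a - 2 * e) + B * (a + e)) + S - E + a * (M * y) < 0 := by
  have hK0 : 0 ≤ K := by linarith
  have hB0 : 0 ≤ B := by linarith
  have hM0 : 0 ≤ M := le_trans (by positivity) hM
  set η := M * (a - 2 * e) + B * (a + e) with hη
  have h1 : |η| ≤ M * K + B * K := by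
    rw [hη]
    refine (abs_add_le _ _).trans (add_le_add ?_ ?_)
    · rw [abs_mul, abs_of_nonneg hM0]
      refine mul_le_mul_of_nonneg_left ?_ hM0
      rw [abs_le]; constructor <;> linarith
    · rw [abs_mul, abs_of_nonneg hB0]
      refine mul_le_mul_of_nonneg_left ?_ hB0
      rw [abs_le]; constructor <;> linarith
  have h2 : (a - e) * η ≤ (a + e) * (M * K + B * K) := by
    calc (a - e) * η ≤ |(a - e) * η| := le_abs_self _
      _ = |a - e| * |η| := abs_mul _ _
      _ ≤ _ := by
        refine mul_le_mul ?_ h1 (abs_nonneg _) (by linarith)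
        rw [abs_le]; constructor <;> linarith
  have h3 : M * (s * y - 4 * c) + B * (s * y + 2 * c) < 0 := by
    nlinarith [mul_nonneg hM0 (sub_nonneg.2 hc)]
  have h4 : (a + e) * (M * (2 * K + y - B) + B * K) ≤ 0 := by
    rw [hB]
    refine mul_nonpos_of_nonneg_of_nonpos (by linarith) ?_
    rw [hB] at hM
    have : 0 ≤ (2 * K + y + 1) * K := by positivity
    linarith
  have h5 : (-M + a - e) * (M ^ 2 + M * (a - 2 * e) + B * (a + e)) + M ^ 3 - e * (M ^ 2 - M * K)
      + a * (M * y) = -(M * B * (a + e)) + (a - e) * η + e * (M * K) + a * (M * y) := by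
    rw [hη]; ring
  have h6 : 0 ≤ a * (M * K) := by positivity
  have h7 : 0 ≤ e * (M * y) := by positivity
  rw [hS]
  nlinarith

/-- If `X` is attached to the rest of `G` exactly through complete edges to `Y`, and the spectral
radius is at least that of the complete graph on the complement of `X`, then few edges are missing
outside `X`. -/
theorem four_mul_card_missing_le {G : SimpleGraph V} [DecidableRel G.Adj] {X Y : Finset V}
    (hdis : Disjoint X Y) (hXY : ∀ x ∈ X, ∀ v, v ∉ X → (G.Adj x v ↔ v ∈ Y)) (hY : Y.Nonempty)
    {M K B c : ℝ} (hMn : M = Fintype.card V - #X) (hc : (#(missing G X).edgeFinset : ℝ) ≤ c)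
    (hK : K = #X + 4 * c) (hB : B = 2 * K + #Y + 1) (hM1 : 2 * (B * K) ≤ M)
    (hM2 : B * (#X * #Y + 2 * c) < M) (hM3 : 3 + 2 * #Y + 2 * #X + K < M)
    (hq : 2 * (M - 1) ≤ q G) : 4 * #(missing G X).edgeFinset ≤ #X * #Y := by
  by_contra hcon
  push Not at hcon
  set F := missing G X with hF
  have hne : Nonempty V := ⟨hY.choose⟩
  set s : ℝ := (#X : ℝ) with hs
  set y : ℝ := (#Y : ℝ) with hy
  set m : ℝ := (#F.edgeFinset : ℝ) with hm
  have hy1 : 1 ≤ y := by rw [hy]; exact_mod_cast hY.card_pos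
  have hs0 : 0 ≤ s := Nat.cast_nonneg _
  have hm0 : 0 ≤ m := Nat.cast_nonneg _
  have hcon' : s * y + 1 ≤ 4 * m := by rw [hs, hy, hm]; exact_mod_cast hcon
  have hK0 : 0 ≤ K := by linarith
  have hB0 : 0 ≤ B := by linarith
  have hM0 : 0 < M := by linarith
  let a : V → ℝ := fun v => if v ∈ Y then s else 0
  let e : V → ℝ := fun v => F.degree v
  have ha0 : ∀ v, 0 ≤ a v := fun v => by simp only [a]; split_ifs <;> simp [hs0]
  have has : ∀ v, a v ≤ s := fun v => by simp only [a]; split_ifs <;> simp [hs0]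
  have he0 : ∀ v, 0 ≤ e v := fun v => Nat.cast_nonneg _
  have hesum : ∑ v, e v = 2 * m := by
    have := F.sum_degrees_eq_twice_card_edges
    simp only [e, hm]
    exact_mod_cast this
  have hec : ∀ v, e v ≤ 2 * c := fun v => by
    have := single_le_sum (f := e) (fun v _ => he0 v) (mem_univ v)
    linarith
  have haK : ∀ v, a v + 2 * e v ≤ K := fun v => by linarith [has v, hec v]
  have heX : ∀ v ∈ X, e v = 0 := fun v hv => by
    simp only [e, Nat.cast_eq_zero, ← SimpleGraph.card_neighborFinset_eq_degree, card_eq_zero]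
    rw [eq_empty_iff_forall_notMem]
    intro u hu
    rw [SimpleGraph.mem_neighborFinset] at hu
    exact hu.2.1 hv
  have haX : ∀ v ∈ X, a v = 0 := fun v hv => if_neg (disjoint_left.1 hdis hv)
  -- M² is the constant eigenvector of the clique, M(a - 2e) its first-order correction for the
  -- edges to X and the missing edges, and B(a + e) a margin that absorbs the second-order errors.
  let w : V → ℝ := fun v => if v ∈ X then M * y else M ^ 2 + M * (a v - 2 * e v) + B * (a v + e v)
  have hwX : ∀ v ∈ X, w v = M * y := fun v hv => if_pos hv
  have hwX' : ∀ v, v ∉ X → w v = M ^ 2 + M * (a v - 2 * e v) + B * (a v + e v) :=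
    fun v hv => if_neg hv
  have hwlow : ∀ v, v ∉ X → M ^ 2 - M * K ≤ w v := fun v hv => by
    rw [hwX' v hv]
    have h1 : 0 ≤ B * (a v + e v) := mul_nonneg hB0 (by linarith [ha0 v, he0 v])
    have h2 : 0 ≤ M * (K + (a v - 2 * e v)) := mul_nonneg hM0.le (by linarith [ha0 v, haK v])
    linarith
  have hwup : ∀ v, v ∉ X → w v ≤ M ^ 2 + M * K + B * K := fun v hv => by
    rw [hwX' v hv]
    have h1 : B * (a v + e v) ≤ B * K := mul_le_mul_of_nonneg_left
      (by linarith [haK v, he0 v]) hB0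
    have h2 : M * (a v - 2 * e v) ≤ M * K := mul_le_mul_of_nonneg_left
      (by linarith [haK v, he0 v]) hM0.le
    linarith
  have hwpos : ∀ v, 0 < w v := fun v => by
    by_cases hv : v ∈ X
    · rw [hwX v hv]; positivity
    · refine lt_of_lt_of_le ?_ (hwlow v hv)
      have : 0 < M * (M - K) := mul_pos hM0 (by linarith)
      linarith
  have hcX : (#Xᶜ : ℝ) = M := by
    rw [card_compl, Nat.cast_sub (card_le_univ _), hMn]
  have hsum0 : ∀ f : V → ℝ, (∀ v ∈ X, f v = 0) → ∑ v ∈ Xᶜ, f v = ∑ v, f v := fun f hf =>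
    sum_subset (subset_univ _) fun v _ hv => hf v (by simpa using hv)
  have hasum : ∑ v, a v = s * y := by
    simp only [a]
    rw [← sum_filter, filter_univ_mem, sum_const, nsmul_eq_mul, mul_comm]
  have hwsum : ∑ v ∈ Xᶜ, w v = M ^ 3 + M * (s * y - 4 * m) + B * (s * y + 2 * m) := by
    rw [sum_congr rfl fun v hv => hwX' v (by simpa using hv), sum_add_distrib, sum_add_distrib,
      ← mul_sum, ← mul_sum, sum_sub_distrib, sum_add_distrib, ← mul_sum, hsum0 a haX,
      hsum0 e heX, hasum, hesum, sum_const, nsmul_eq_mul, hcX]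
    ring
  obtain ⟨v, hv⟩ := exists_q_mul_le G hwpos
  have hv' := (mul_le_mul_of_nonneg_right hq (hwpos v).le).trans hv
  -- On X there is a factor 2 to spare: the neighbours in Y contribute about yM², against 2(M -
  -- 1)My.
  by_cases hvX : v ∈ X
  · have hN : G.neighborFinset v ⊆ Y ∪ X := fun u hu => by
      rw [SimpleGraph.mem_neighborFinset] at hu
      rw [mem_union]
      by_cases h : u ∈ X
      · exact Or.inr h
      · exact Or.inl ((hXY v hvX u h).1 hu)
    have hd : (G.degree v : ℝ) ≤ y + s := by
      have := (card_le_card hN).trans (card_union_le _ _)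
      rw [SimpleGraph.card_neighborFinset_eq_degree] at this
      rw [hy, hs]; exact_mod_cast this
    have h1 : ∑ u ∈ G.neighborFinset v, w u ≤ y * (M ^ 2 + M * K + B * K) + s * (M * y) := by
      refine (sum_le_sum_of_subset_of_nonneg hN fun u _ _ => (hwpos u).le).trans ?_
      rw [sum_union hdis.symm]
      refine add_le_add ?_ ?_
      · rw [hy, ← nsmul_eq_mul]
        exact sum_le_card_nsmul _ _ _ fun u hu => hwup u fun h => disjoint_left.1 hdis h hu
      · rw [sum_congr rfl hwX, sum_const, nsmul_eq_mul]
    rw [hwX v hvX] at hv'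
    have h2 : (G.degree v : ℝ) * (M * y) ≤ (y + s) * (M * y) :=
      mul_le_mul_of_nonneg_right hd (by positivity)
    have h3 : y * (2 * (M - 1) * M) ≤ y * ((y + s) * M + (M ^ 2 + M * K + B * K) + s * M) := by
      linarith
    have h4 := le_of_mul_le_mul_left h3 (by linarith)
    have h5 : 0 < M * (M - (3 + 2 * y + 2 * s + K)) := mul_pos hM0 (by linarith)
    have h6 : 0 ≤ y * M := by positivity
    have h7 : 0 ≤ B * K := by positivity
    nlinarith
  · have h1 := sum_neighborFinset_add hXY w hvX
    have h2 := sum_neighborFinset_add hXY (fun _ => (1 : ℝ)) hvX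
    have h3 : (if v ∈ Y then ∑ u ∈ X, w u else 0) = a v * (M * y) := by
      rw [sum_congr rfl hwX, sum_const, nsmul_eq_mul]
      simp only [a]; split_ifs <;> simp [hs]
    have h4 : (if v ∈ Y then ∑ u ∈ X, (1 : ℝ) else 0) = a v := by
      simp only [a]; split_ifs <;> simp [hs]
    rw [h3, hwsum] at h1
    rw [h4] at h2
    simp only [sum_const, nsmul_eq_mul, mul_one, SimpleGraph.card_neighborFinset_eq_degree,
      hcX] at h2
    have h5 : e v * (M ^ 2 - M * K) ≤ ∑ u ∈ F.neighborFinset v, w u := by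
      simp only [e]
      rw [← SimpleGraph.card_neighborFinset_eq_degree, ← nsmul_eq_mul]
      refine card_nsmul_le_sum _ _ _ fun u hu => hwlow u ?_
      rw [SimpleGraph.mem_neighborFinset] at hu
      exact hu.2.2.1
    have hM2' : B * (s * y + 2 * m) < M := by
      refine lt_of_le_of_lt (mul_le_mul_of_nonneg_left ?_ hB0) hM2
      linarith
    have h6 := weight_bound (ha0 v) (he0 v) (haK v) hB (by linarith) hM1 hM2' hcon' _ _ rfl h5
    have h7 : (G.degree v : ℝ) = M + a v - 1 - e v := by
      simp only [e]; linarith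
    rw [← hwX' v hvX] at h6
    rw [h7] at hv'
    nlinarith

end Spectral

/-! ### Obstructions to cycles, and recognition of the two families -/

section Parts

variable {V : Type*} [DecidableEq V]

/-- The successor permutation lets both obstructions be proved by finding a proper subset closed
under it. -/
theorem HamOn.exists_perm {G : SimpleGraph V} {T : Finset V} (h : HamOn G T) :
    ∃ σ : Equiv.Perm V, σ.IsCycleOn T ∧ ∀ v ∈ T, G.Adj v (σ v) := by
  obtain ⟨l, h1, rfl, h3, h4, h5⟩ := h
  refine ⟨l.formPerm, ?_, ?_⟩
  · have := h1.isCycleOn_formPerm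
    convert this using 1
    ext; simp
  · intro v hv
    rw [List.mem_toFinset] at hv
    obtain ⟨i, hi, rfl⟩ := List.getElem_of_mem hv
    rw [List.formPerm_apply_getElem _ h1]
    by_cases hi' : i + 1 < l.length
    · simp only [Nat.mod_eq_of_lt hi']
      exact h4.getElem i hi'
    · have e : i + 1 = l.length := by omega
      have e' : (i + 1) % l.length = 0 := by rw [e, Nat.mod_self]
      simp only [e']
      refine h5 _ ?_ _ ?_
      · rw [List.getLast?_eq_getElem?, ← e, Nat.add_sub_cancel, List.getElem?_eq_getElem hi]; rfl
      · rw [List.head?_eq_getElem?, List.getElem?_eq_getElem (by omega)]; rfl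

omit [DecidableEq V] in
theorem subset_of_isCycleOn {σ : Equiv.Perm V} {T A : Finset V} (hσ : σ.IsCycleOn T)
    (hA : A ⊆ T) (hne : A.Nonempty) (hcl : ∀ v ∈ A, σ v ∈ A) : T ⊆ A := by
  intro b hb
  obtain ⟨a, ha⟩ := hne
  obtain ⟨n, -, rfl⟩ := hσ.exists_pow_eq (hA ha) hb
  clear hb
  induction n with
  | zero => simpa
  | succ n ih => rw [pow_succ']; exact hcl _ ih

/-- If an independent set `X` sees at most `#X` vertices `Y` of `T`, and `T` has further vertices,
then there is no cycle on `T`. -/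
theorem not_hamOn_of_independent {G : SimpleGraph V} {T X Y : Finset V} (hX : X ⊆ T) (hY : Y ⊆ T)
    (hne : X.Nonempty) (hcard : #Y ≤ #X) (hN : ∀ x ∈ X, ∀ v ∈ T, G.Adj x v → v ∈ Y)
    (hT : ¬ T ⊆ X ∪ Y) : ¬ HamOn G T := by
  intro h
  obtain ⟨σ, hσ, hadj⟩ := h.exists_perm
  have hm : ∀ v, σ v ∈ T ↔ v ∈ T := fun v => hσ.apply_mem_iff
  have h1 : X.image σ ⊆ Y := by
    intro v hv
    obtain ⟨x, hx, rfl⟩ := mem_image.1 hv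
    exact hN x hx _ ((hm x).2 (hX hx)) (hadj x (hX hx))
  have hm' : ∀ v ∈ T, σ.symm v ∈ T := fun v hv => (hm _).1 (by simpa)
  have h2 : X.image σ.symm ⊆ Y := by
    intro v hv
    obtain ⟨x, hx, rfl⟩ := mem_image.1 hv
    have := hadj _ (hm' x (hX hx))
    rw [Equiv.apply_symm_apply] at this
    exact hN x hx _ (hm' x (hX hx)) this.symm
  -- All predecessors of X lie in Y, and #Y ≤ #X makes them all of Y. So successors of Y lie in X,
  -- successors of X lie in Y, and the cycle never leaves X ∪ Y.
  have h3 : X.image σ.symm = Y :=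
    eq_of_subset_of_card_le h2 (by rwa [card_image_of_injective _ σ.symm.injective])
  refine hT (subset_of_isCycleOn hσ (union_subset hX hY) (hne.mono subset_union_left) ?_)
  intro v hv
  rw [mem_union] at hv ⊢
  rcases hv with hv | hv
  · exact Or.inr (h1 (mem_image_of_mem _ hv))
  · rw [← h3] at hv
    obtain ⟨x, hx, rfl⟩ := mem_image.1 hv
    left; simpa

/-- A cut vertex `y` that separates `X` from the rest of `T` excludes a cycle on `T`. -/
theorem not_hamOn_of_cut {G : SimpleGraph V} {T X : Finset V} {y : V} (hX : X ⊆ T) (hy : y ∈ T)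
    (hyX : y ∉ X) (hne : X.Nonempty) (hN : ∀ x ∈ X, ∀ v ∈ T, v ∉ X → G.Adj x v → v = y)
    (hT : ¬ T ⊆ insert y X) : ¬ HamOn G T := by
  intro h
  obtain ⟨σ, hσ, hadj⟩ := h.exists_perm
  have hm : ∀ v, σ v ∈ T ↔ v ∈ T := fun v => hσ.apply_mem_iff
  -- If the successor of y is in X, the cycle never leaves X ∪ {y}; otherwise it never enters X.
  by_cases hyσ : σ y ∈ X
  · refine hT (subset_of_isCycleOn hσ (insert_subset hy hX) (insert_nonempty _ _) ?_)
    intro v hv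
    rw [mem_insert] at hv
    rcases hv with rfl | hv
    · exact mem_insert_of_mem hyσ
    · rw [mem_insert]
      by_cases h : σ v ∈ X
      · exact Or.inr h
      · exact Or.inl (hN v hv _ ((hm v).2 (hX hv)) h (hadj v (hX hv)))
  · have : T ⊆ T \ X := by
      refine subset_of_isCycleOn hσ sdiff_subset ⟨y, mem_sdiff.2 ⟨hy, hyX⟩⟩ ?_
      intro v hv
      obtain ⟨hvT, hvX⟩ := mem_sdiff.1 hv
      refine mem_sdiff.2 ⟨(hm v).2 hvT, fun h => ?_⟩
      have := hN _ h v hvT hvX (hadj v hvT).symm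
      exact hyσ (this ▸ h)
    obtain ⟨x, hx⟩ := hne
    exact (mem_sdiff.1 (this (hX hx))).2 hx

section Families

variable {y z s : ℕ} {R : SimpleGraph (Fin s)}

theorem join_adj_of_ne {a b : Fin y ⊕ (Fin z ⊕ Fin s)} (hab : a ≠ b)
    (ha : a ∈ partYZ (Fin y) (Fin z) (Fin s)) (hb : b ∈ partYZ (Fin y) (Fin z) (Fin s)) :
    (join (⊤ : SimpleGraph (Fin y)) ((⊤ : SimpleGraph (Fin z)) ⊕g R)).Adj a b := by
  rcases a with a | a | a <;> rcases b with b | b | b <;>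
    simp_all [join, partYZ]

theorem notMem_partYZ (i : Fin s) : Sum.inr (Sum.inr i) ∉ partYZ (Fin y) (Fin z) (Fin s) := by
  simp [partYZ]

omit [DecidableEq V] in
/-- The sets `X` and `Y` in a graph of one of the two families. -/
theorem exists_parts_of_iso [Fintype V] {G : SimpleGraph V}
    {E : Set (Sym2 (Fin y ⊕ (Fin z ⊕ Fin s)))}
    (hE : E ⊆ edgesYZ (join (⊤ : SimpleGraph (Fin y)) ((⊤ : SimpleGraph (Fin z)) ⊕g R)))
    (φ : G ≃g (join (⊤ : SimpleGraph (Fin y)) ((⊤ : SimpleGraph (Fin z)) ⊕g R)).deleteEdges E) :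
    ∃ X Y : Finset V, Disjoint X Y ∧ #X = s ∧ #Y = y ∧ Fintype.card V = y + z + s ∧
      (∀ x ∈ X, ∀ v, v ∉ X → (G.Adj x v ↔ v ∈ Y)) ∧
      (R = ⊥ → ∀ u ∈ X, ∀ v ∈ X, ¬ G.Adj u v) := by
  let f : Fin s ↪ V := ⟨fun i => φ.symm (Sum.inr (Sum.inr i)), fun i j h => by simpa using h⟩
  let g : Fin y ↪ V := ⟨fun i => φ.symm (Sum.inl i), fun i j h => by simpa using h⟩
  have hadj : ∀ i b, G.Adj (φ.symm (Sum.inr (Sum.inr i))) (φ.symm b) ↔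
      (join (⊤ : SimpleGraph (Fin y)) ((⊤ : SimpleGraph (Fin z)) ⊕g R)).Adj
        (Sum.inr (Sum.inr i)) b := by
    intro i b
    rw [φ.symm.map_adj_iff, SimpleGraph.deleteEdges_adj]
    refine and_iff_left fun h => notMem_partYZ (y := y) (z := z) i ((hE h).2 _ (by simp))
  refine ⟨univ.map f, univ.map g, ?_, by simp, by simp, ?_, ?_, ?_⟩
  · rw [disjoint_left]
    intro v hv hv'
    simp only [mem_map, mem_univ, true_and] at hv hv'
    obtain ⟨i, rfl⟩ := hv
    obtain ⟨j, hj⟩ := hv'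
    have := φ.symm.injective hj
    simp at this
  · rw [Fintype.card_congr φ.toEquiv]; simp [add_assoc]
  · intro x hx v hv
    simp only [mem_map, mem_univ, true_and] at hx hv ⊢
    obtain ⟨i, rfl⟩ := hx
    obtain ⟨b, rfl⟩ := φ.symm.surjective v
    change G.Adj (φ.symm (Sum.inr (Sum.inr i))) _ ↔ _
    rw [hadj]
    rcases b with b | b | b
    · simp [join, g]
    · have : ∀ x : Fin y, φ.symm (Sum.inl x) ≠ φ.symm (Sum.inr (Sum.inl b)) := fun x h => by
        simpa using φ.symm.injective h
      simpa [join, g] using this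
    · exact absurd ⟨b, rfl⟩ hv
  · rintro rfl u hu v hv
    simp only [mem_map, mem_univ, true_and] at hu hv
    obtain ⟨i, rfl⟩ := hu
    obtain ⟨j, rfl⟩ := hv
    change ¬ G.Adj (φ.symm (Sum.inr (Sum.inr i))) (φ.symm (Sum.inr (Sum.inr j)))
    rw [hadj]
    simp [join]

/-- Conversely, the parts `X` and `Y` and few missing edges identify a member of the families. -/
theorem exists_iso_of_parts [Fintype V] {G : SimpleGraph V} [DecidableRel G.Adj] {X Y : Finset V}
    (hdis : Disjoint X Y) (hXY : ∀ x ∈ X, ∀ v, v ∉ X → (G.Adj x v ↔ v ∈ Y))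
    (hX : #X = s) (hY : #Y = y) (hV : Fintype.card V = y + z + s)
    (hR : (R = ⊥ ∧ ∀ u ∈ X, ∀ v ∈ X, ¬ G.Adj u v) ∨
      (R = ⊤ ∧ ∀ u ∈ X, ∀ v ∈ X, u ≠ v → G.Adj u v)) :
    ∃ E : Finset (Sym2 (Fin y ⊕ (Fin z ⊕ Fin s))),
      (E : Set (Sym2 _)) ⊆
        edgesYZ (join (⊤ : SimpleGraph (Fin y)) ((⊤ : SimpleGraph (Fin z)) ⊕g R)) ∧
      #E = #(missing G X).edgeFinset ∧
      Nonempty (G ≃g (join (⊤ : SimpleGraph (Fin y))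
        ((⊤ : SimpleGraph (Fin z)) ⊕g R)).deleteEdges (E : Set (Sym2 _))) := by
  classical
  have hZ : #(X ∪ Y)ᶜ = z := by
    rw [card_compl, card_union_of_disjoint hdis]; omega
  let eX := (X.equivFinOfCardEq hX).symm
  let eY := (Y.equivFinOfCardEq hY).symm
  let eZ := ((X ∪ Y)ᶜ.equivFinOfCardEq hZ).symm
  let f : Fin y ⊕ (Fin z ⊕ Fin s) → V :=
    Sum.elim (fun i => eY i) (Sum.elim (fun i => eZ i) (fun i => eX i))
  have hfY : ∀ i, f (Sum.inl i) ∈ Y := fun i => (eY i).2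
  have hfX : ∀ i, f (Sum.inr (Sum.inr i)) ∈ X := fun i => (eX i).2
  have hfZ : ∀ i, f (Sum.inr (Sum.inl i)) ∉ X ∧ f (Sum.inr (Sum.inl i)) ∉ Y := fun i => by
    have := (eZ i).2
    rw [mem_compl, mem_union, not_or] at this
    exact this
  have hYX : ∀ v ∈ Y, v ∉ X := fun v h h' => disjoint_left.1 hdis h' h
  have hinj : Function.Injective f := by
    rintro (a | a | a) (b | b | b) hab
    · have : eY a = eY b := Subtype.ext hab
      simpa using this
    · exact absurd (hab ▸ hfY a) (hfZ b).2
    · exact absurd (hab ▸ hfX b) (hYX _ (hfY a))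
    · exact absurd (hab ▸ hfY b) (hfZ a).2
    · have : eZ a = eZ b := Subtype.ext hab
      simpa using this
    · exact absurd (hab ▸ hfX b) (hfZ a).1
    · exact absurd (hab ▸ hfX a) (hYX _ (hfY b))
    · exact absurd (hab ▸ hfX a) (hfZ b).1
    · have : eX a = eX b := Subtype.ext hab
      simpa using this
  let φ : Fin y ⊕ (Fin z ⊕ Fin s) ≃ V := Equiv.ofBijective f
    ((Fintype.bijective_iff_injective_and_card f).2 ⟨hinj, by simp [hV, add_assoc]⟩)
  have hφ : ∀ a, φ a = f a := fun _ => rfl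
  have hpart : ∀ a, f a ∉ X ↔ a ∈ partYZ (Fin y) (Fin z) (Fin s) := by
    rintro (a | a | a)
    · simp [hYX _ (hfY a), partYZ]
    · simp [(hfZ a).1, partYZ]
    · simp [hfX a, partYZ]
  let F := (missing G X).comap φ
  have hF : ∀ a b, F.Adj a b ↔ a ≠ b ∧ f a ∉ X ∧ f b ∉ X ∧ ¬ G.Adj (f a) (f b) := by
    intro a b
    change f a ≠ f b ∧ _ ↔ _
    rw [hinj.ne_iff]; rfl
  refine ⟨F.edgeFinset, ?_, ?_, ?_⟩
  · intro e he
    rw [SimpleGraph.coe_edgeFinset] at he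
    induction e with | h a b
    rw [SimpleGraph.mem_edgeSet, hF, hpart, hpart] at he
    refine ⟨join_adj_of_ne he.1 he.2.1 he.2.2.1, fun v hv => ?_⟩
    rw [Sym2.mem_iff] at hv
    rcases hv with rfl | rfl
    · exact he.2.1
    · exact he.2.2.1
  · exact SimpleGraph.Iso.card_edgeFinset_eq (SimpleGraph.Iso.comap φ (missing G X))
  · refine ⟨SimpleGraph.Iso.symm ⟨φ, fun {a b} => ?_⟩⟩
    rw [SimpleGraph.deleteEdges_adj, SimpleGraph.coe_edgeFinset, SimpleGraph.mem_edgeSet, hF, hφ,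
      hφ]
    by_cases hab : a = b
    · subst hab; simp
    by_cases ha : f a ∈ X
    · by_cases hb : f b ∈ X
      · obtain ⟨i, rfl⟩ : ∃ i, a = Sum.inr (Sum.inr i) := by
          rcases a with a | a | a
          · exact absurd ha (hYX _ (hfY a))
          · exact absurd ha (hfZ a).1
          · exact ⟨a, rfl⟩
        obtain ⟨j, rfl⟩ : ∃ i, b = Sum.inr (Sum.inr i) := by
          rcases b with a | a | a
          · exact absurd hb (hYX _ (hfY a))
          · exact absurd hb (hfZ a).1
          · exact ⟨a, rfl⟩
        have hij : i ≠ j := fun h => hab (by rw [h])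
        rcases hR with ⟨rfl, h⟩ | ⟨rfl, h⟩
        · simp [join, h _ ha _ hb]
        · simp [join, h _ ha _ hb (hinj.ne hab), hij, ha]
      · rw [hXY _ ha _ hb]
        rcases a with a | a | a
        · exact absurd ha (hYX _ (hfY a))
        · exact absurd ha (hfZ a).1
        · rcases b with b | b | b
          · simp [join, hfY, ha]
          · simp [join, (hfZ b).2]
          · exact absurd (hfX b) hb
    · by_cases hb : f b ∈ X
      · rw [G.adj_comm, hXY _ hb _ ha]
        rcases b with b | b | b
        · exact absurd hb (hYX _ (hfY b))
        · exact absurd hb (hfZ b).1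
        · rcases a with a | a | a
          · simp [join, hfY, hb]
          · simp [join, (hfZ a).2]
          · exact absurd (hfX a) ha
      · have := join_adj_of_ne (R := R) hab ((hpart a).1 ha) ((hpart b).1 hb)
        simp [this, hab, ha, hb]

end Families

end Parts

/-! ### From a non-Hamiltonian subgraph to the extremal structure -/

section Extremal

variable {V : Type*} [Fintype V] [DecidableEq V]

omit [DecidableEq V] in
theorem degOn_univ (G : SimpleGraph V) [DecidableRel G.Adj] (v : V) :
    degOn G univ v = G.degree v := by
  rw [degOn, ← SimpleGraph.card_neighborFinset_eq_degree, SimpleGraph.neighborFinset_eq_filter]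
  congr!

theorem degOn_compl_add (G : SimpleGraph V) (S : Finset V) (v : V) :
    degOn G Sᶜ v + degOn G S v = degOn G univ v := by
  classical
  unfold degOn
  rw [← card_union_of_disjoint (disjoint_compl_left.mono (filter_subset _ _) (filter_subset _ _)),
    ← filter_union, union_comm, union_compl]

omit [Fintype V] [DecidableEq V] in
theorem degOn_le_card_self (G : SimpleGraph V) (T : Finset V) (v : V) : degOn G T v ≤ #T := by
  classical
  exact card_filter_le _ _

omit [Fintype V] [DecidableEq V] in
theorem degOn_mono {G C : SimpleGraph V} (h : G ≤ C) (T : Finset V) (v : V) :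
    degOn G T v ≤ degOn C T v := by
  classical
  exact card_le_card (monotone_filter_right T fun u _ hu => h hu)

omit [Fintype V] [DecidableEq V] in
theorem adj_of_degOn_le {G C : SimpleGraph V} (h : G ≤ C) {T : Finset V} {v : V}
    (hd : degOn C T v ≤ degOn G T v) {u : V} (hu : u ∈ T) (hadj : C.Adj v u) : G.Adj v u := by
  classical
  have h1 := eq_of_subset_of_card_le (monotone_filter_right T fun u _ hu => h hu) hd
  have h2 : u ∈ {u ∈ T | C.Adj v u} := mem_filter.2 ⟨hu, hadj⟩
  rw [← h1] at h2
  exact (mem_filter.1 h2).2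

omit [Fintype V] [DecidableEq V] in
theorem adj_of_card_le_degOn {G : SimpleGraph V} {T : Finset V} {v : V}
    (hd : #T ≤ degOn G T v) {u : V} (hu : u ∈ T) : G.Adj v u := by
  classical
  rw [← eq_of_subset_of_card_le (filter_subset _ _) hd] at hu
  exact (mem_filter.1 hu).2

omit [Fintype V] in
theorem codegOn_mono {G C : SimpleGraph V} (h : G ≤ C) {S T : Finset V} (hST : S ⊆ T) (v : V) :
    codegOn C S v ≤ codegOn G T v := by
  classical
  refine card_le_card fun u hu => ?_
  rw [mem_filter] at hu ⊢
  exact ⟨hST hu.1, hu.2.1, fun e => hu.2.2 (h e)⟩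

/-- In C each vertex of X has only s neighbours in the complement of S, while its degree in G is at
least k + s. Since #S ≤ k, every inequality is tight, so the structure found in C passes to G, and
all of S joins the attachment set. -/
theorem exists_parts_of_not_hamOn {G : SimpleGraph V} [DecidableRel G.Adj] {S : Finset V}
    {s k : ℕ} (hs : 2 ≤ s) (hS : #S ≤ k) (hG : ¬ HamOn G Sᶜ) (hdeg : ∀ v, k + s ≤ G.degree v)
    (hmiss : ∑ v, codegOn G univ v ≤ 2 * s * Fintype.card V)
    (hn : k + (10 * s + 4 * k + 6 + (s + 1) * (15 * s) + 2 * s * k) ≤ Fintype.card V) :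
    ∃ X Y : Finset V, Disjoint X Y ∧ #X = s ∧ (∀ x ∈ X, ∀ v, v ∉ X → (G.Adj x v ↔ v ∈ Y)) ∧
      ((#Y = k + 1 ∧ ∀ u ∈ X, ∀ v ∈ X, u ≠ v → G.Adj u v) ∨
        (#Y = k + s ∧ ∀ u ∈ X, ∀ v ∈ X, ¬ G.Adj u v)) := by
  classical
  obtain ⟨C, hGC, hC, hore⟩ := exists_ore_closed hG
  have hcT : #Sᶜ + #S = Fintype.card V := card_compl_add_card S
  have hle := degOn_mono hGC Sᶜ
  have hlS := degOn_le_card_self G S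
  have hsplit : ∀ v, degOn G Sᶜ v + degOn G S v = G.degree v := fun v => by
    rw [degOn_compl_add, degOn_univ]
  obtain ⟨X, Y, hX, hY, hXY, hXs, hdX, hadj, hYs⟩ := structure_of_not_hamOn (k := k) hs hC hore
    (fun v _ => by
      have := hdeg v
      have := hsplit v
      have := hle v
      have := hlS v
      omega)
    (by
      calc ∑ v ∈ Sᶜ, codegOn C Sᶜ v ≤ ∑ v ∈ Sᶜ, codegOn G univ v :=
            sum_le_sum fun v _ => codegOn_mono hGC (subset_univ _) v
        _ ≤ ∑ v, codegOn G univ v := sum_le_sum_of_subset (subset_univ _)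
        _ ≤ 2 * s * Fintype.card V := hmiss
        _ ≤ 2 * s * (#Sᶜ + k) := Nat.mul_le_mul_left _ (by omega))
    (by omega)
  have hGCX : ∀ x ∈ X, ∀ v ∈ Sᶜ, G.Adj x v ↔ C.Adj x v := by
    intro x hx v hv
    refine ⟨fun h => hGC h, adj_of_degOn_le hGC ?_ hv⟩
    have := hdeg x
    have := hsplit x
    have := hlS x
    have := hdX x hx
    omega
  have hdS : ∀ x ∈ X, k ≤ degOn G S x := fun x hx => by
    have := hdeg x
    have := hsplit x
    have := hdX x hx
    have := hle x
    omega
  have hSk : #S = k := by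
    obtain ⟨x, hx⟩ : X.Nonempty := card_pos.1 (by omega)
    have := hdS x hx
    have := hlS x
    omega
  have hSX : ∀ x ∈ X, ∀ v ∈ S, G.Adj x v := fun x hx v hv =>
    adj_of_card_le_degOn (hSk.trans_le (hdS x hx)) hv
  have hSY : Disjoint S Y := disjoint_compl_right.mono_right hY
  have hXS : Disjoint X S := disjoint_compl_left.mono_left hX
  refine ⟨X, S ∪ Y, disjoint_union_right.2 ⟨hXS, hXY⟩, hXs, ?_, ?_⟩
  · intro x hx v hv
    rw [mem_union]
    by_cases hvS : v ∈ S
    · simp [hSX x hx v hvS, hvS]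
    · rw [hGCX x hx v (mem_compl.2 hvS), hadj x hx v (mem_sdiff.2 ⟨mem_compl.2 hvS, hv⟩)]
      simp [hvS]
  · rw [card_union_of_disjoint hSY, hSk]
    rcases hYs with ⟨h1, h2⟩ | ⟨h1, h2⟩
    · exact Or.inl ⟨by rw [h1], fun u hu v hv huv => (hGCX u hu v (hX hv)).2 (h2 u hu v hv huv)⟩
    · exact Or.inr ⟨by rw [h1], fun u hu v hv huv => h2 u hu v hv (hGC huv)⟩

theorem sum_codegOn_le_of_le_q [Nonempty V] {G : SimpleGraph V} [DecidableRel G.Adj]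
    (hd : ∀ v, 0 < G.degree v) {s : ℕ} (hq : 2 * ((Fintype.card V : ℝ) - s - 1) ≤ q G) :
    ∑ v, codegOn G univ v ≤ 2 * s * Fintype.card V := by
  have h1 := le_sum_degree_of_le_q G hd hq
  have h2 : ∑ v, G.degree v + ∑ v, codegOn G univ v + Fintype.card V =
      Fintype.card V * Fintype.card V := by
    have h3 : ∑ v : V, (degOn G univ v + codegOn G univ v + 1) = ∑ v : V, Fintype.card V :=
      sum_congr rfl fun v _ => degOn_add_codegOn (mem_univ v)
    simpa [sum_add_distrib, degOn_univ] using h3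
  have h2' : ((∑ v, G.degree v : ℕ) : ℝ) + ((∑ v, codegOn G univ v : ℕ) : ℝ) + Fintype.card V =
      Fintype.card V * Fintype.card V := by exact_mod_cast h2
  rw [Nat.cast_sum] at h2'
  have : ((∑ v, codegOn G univ v : ℕ) : ℝ) ≤ 2 * s * Fintype.card V := by linarith
  exact_mod_cast this

/-- An a priori bound for the number of missing edges. -/
theorem card_missing_le_of_le_q [Nonempty V] {G : SimpleGraph V} [DecidableRel G.Adj]
    {X Y : Finset V} (hdis : Disjoint X Y)
    (hXY : ∀ x ∈ X, ∀ v, v ∉ X → (G.Adj x v ↔ v ∈ Y)) (hd : ∀ v, 0 < G.degree v)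
    (hq : 2 * ((Fintype.card V : ℝ) - #X - 1) ≤ q G) :
    (#(missing G X).edgeFinset : ℝ) ≤ #X * (#X + #Y + 1) := by
  have h1 := le_sum_degree_of_le_q G hd hq
  have h2 : ∀ v ∈ X, (G.degree v : ℝ) ≤ #Y + #X := fun v hv => by
    have hN : G.neighborFinset v ⊆ Y ∪ X := fun u hu => by
      rw [SimpleGraph.mem_neighborFinset] at hu
      rw [mem_union]
      by_cases h : u ∈ X
      · exact Or.inr h
      · exact Or.inl ((hXY v hv u h).1 hu)
    have := (card_le_card hN).trans (card_union_le _ _)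
    rw [SimpleGraph.card_neighborFinset_eq_degree] at this
    exact_mod_cast this
  have h3 := sum_le_card_nsmul X (fun v => (G.degree v : ℝ)) _ h2
  rw [nsmul_eq_mul] at h3
  have hcX : (#Xᶜ : ℝ) = Fintype.card V - #X := by
    rw [card_compl, Nat.cast_sub (card_le_univ _)]
  have h4 : ∀ v ∈ Xᶜ, (G.degree v : ℝ) + (missing G X).degree v =
      (Fintype.card V - #X - 1) + if v ∈ Y then (#X : ℝ) else 0 := fun v hv => by
    have := sum_neighborFinset_add hXY (fun _ => (1 : ℝ)) (mem_compl.1 hv)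
    simp only [sum_const, nsmul_eq_mul, mul_one, SimpleGraph.card_neighborFinset_eq_degree,
      hcX] at this
    linarith
  have h5 := sum_congr rfl h4
  rw [sum_add_distrib, sum_add_distrib, sum_const, nsmul_eq_mul, hcX] at h5
  have h6 : ∑ v ∈ Xᶜ, (if v ∈ Y then (#X : ℝ) else 0) = #Y * #X := by
    rw [← sum_filter, sum_const, nsmul_eq_mul]
    congr 3
    ext v
    simp only [mem_filter, mem_compl]
    exact ⟨fun h => h.2, fun h => ⟨fun h' => disjoint_left.1 hdis h' h, h⟩⟩
  have h7 : ∑ v ∈ Xᶜ, ((missing G X).degree v : ℝ) = 2 * #(missing G X).edgeFinset := by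
    have := (missing G X).sum_degrees_eq_twice_card_edges
    rw [← Nat.cast_sum, sum_subset (subset_univ Xᶜ), this]
    · push_cast; ring
    · intro v _ hv
      rw [mem_compl, not_not] at hv
      rw [← SimpleGraph.card_neighborFinset_eq_degree, card_eq_zero, eq_empty_iff_forall_notMem]
      intro u hu
      rw [SimpleGraph.mem_neighborFinset] at hu
      exact hu.2.1 hv
  have h8 : ∑ v ∈ Xᶜ, (G.degree v : ℝ) + ∑ v ∈ X, (G.degree v : ℝ) = ∑ v, (G.degree v : ℝ) := by
    rw [add_comm]; exact sum_add_sum_compl X _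
  have h9 : (0 : ℝ) ≤ #X := Nat.cast_nonneg _
  have h10 : (0 : ℝ) ≤ #(missing G X).edgeFinset := Nat.cast_nonneg _
  -- The identity (n - s)(n - s - 1) = n(n - 1) - 2sn + s² + s cancels all terms in n between the
  -- degree count and its lower bound.
  nlinarith

end Extremal

/-- For large graphs the bound on the number of missing edges is the sharp one. -/
theorem exists_four_mul_card_missing_le (s y : ℕ) (hy : 0 < y) :
    ∃ N : ℕ, ∀ (V : Type*) [Fintype V] [DecidableEq V] (G : SimpleGraph V) [DecidableRel G.Adj],
      N ≤ Fintype.card V → (∀ v, 0 < G.degree v) → ∀ X Y : Finset V, Disjoint X Y → #X = s →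
        #Y = y → (∀ x ∈ X, ∀ v, v ∉ X → (G.Adj x v ↔ v ∈ Y)) →
        2 * ((Fintype.card V : ℝ) - s - 1) ≤ q G → 4 * #(missing G X).edgeFinset ≤ s * y := by
  let c : ℕ := s * (s + y + 1)
  let K : ℕ := s + 4 * c
  let B : ℕ := 2 * K + y + 1
  -- The summand `s` accounts for M = n - s; the next three are the size conditions on M.
  refine ⟨s + 2 * (B * K) + B * (s * y + 2 * c) + (3 + 2 * y + 2 * s + K) + 1, ?_⟩
  intro V _ _ G _ hN hd X Y hdis hX hY hXY hq
  have hYne : Y.Nonempty := card_pos.1 (by omega)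
  have : Nonempty V := ⟨hYne.choose⟩
  subst hX hY
  have hN' : ((#X + 2 * (B * K) + B * (#X * #Y + 2 * c) + (3 + 2 * #Y + 2 * #X + K) + 1 : ℕ) : ℝ)
      ≤ Fintype.card V := by exact_mod_cast hN
  push_cast at hN'
  have hc := card_missing_le_of_le_q hdis hXY hd hq
  have e1 : (0 : ℝ) ≤ B * K := by positivity
  have e2 : (0 : ℝ) ≤ B * (#X * #Y + 2 * c) := by positivity
  have e3 : (0 : ℝ) ≤ 3 + 2 * #Y + 2 * #X + K := by positivity
  refine four_mul_card_missing_le hdis hXY hYne (c := c) (K := K) (B := B) rfl ?_ ?_ ?_ ?_ ?_ ?_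
    hq
  · simpa [c] using hc
  · simp [K]
  · simp [B]
  · linarith
  · linarith
  · linarith

/-! ### The exceptional graphs are not k-Hamiltonian -/

section NotHamiltonian

variable {V : Type*} [Fintype V] [DecidableEq V] {n k δ : ℕ} {G : SimpleGraph V}

/-- Delete k vertices of Y: the δ - k independent vertices of X see only δ - k remaining vertices,
while vertices of Z are still to be covered. -/
theorem InFamilyH.not_isKHamiltonian (h : InFamilyH n k δ G) (hδ : k < δ) (hn : 2 * δ < n + k) :
    ¬ IsKHamiltonian G k := by
  obtain ⟨E, hE, -, ⟨φ⟩⟩ := h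
  obtain ⟨X, Y, hdis, hX, hY, hV, hadj, hind⟩ := exists_parts_of_iso hE φ
  rw [isKHamiltonian_iff]
  intro hk
  obtain ⟨S, hSY, hS⟩ := exists_subset_card_eq (s := Y) (n := k) (by omega)
  have hYS : #(Y \ S) = δ - k := by rw [card_sdiff_of_subset hSY, hS, hY]
  refine not_hamOn_of_independent (X := X) (Y := Y \ S) (T := Sᶜ) ?_ ?_ ?_ ?_ ?_ ?_ (hk S hS.le)
  · intro x hx
    rw [mem_compl]
    exact fun h => disjoint_left.1 hdis hx (hSY h)
  · intro x hx
    rw [mem_compl]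
    exact (mem_sdiff.1 hx).2
  · exact card_pos.1 (by omega)
  · omega
  · intro x hx v hv hxv
    refine mem_sdiff.2 ⟨(hadj x hx v fun h => ?_).1 hxv, mem_compl.1 hv⟩
    exact hind rfl x hx v h hxv
  · intro h
    have h1 := (card_le_card h).trans (card_union_le _ _)
    rw [card_compl] at h1
    omega

/-- Delete k of the k + 1 vertices of Y: the last one separates X from Z. -/
theorem InFamilyL.not_isKHamiltonian (h : InFamilyL n k δ G) (hδ : k < δ) (hn : δ + 1 < n) :
    ¬ IsKHamiltonian G k := by
  obtain ⟨E, hE, -, ⟨φ⟩⟩ := h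
  obtain ⟨X, Y, hdis, hX, hY, hV, hadj, -⟩ := exists_parts_of_iso hE φ
  rw [isKHamiltonian_iff]
  intro hk
  obtain ⟨S, hSY, hS⟩ := exists_subset_card_eq (s := Y) (n := k) (by omega)
  have hYS : #(Y \ S) = 1 := by rw [card_sdiff_of_subset hSY, hS, hY]; omega
  obtain ⟨y, hy⟩ := card_eq_one.1 hYS
  have hyY := mem_sdiff.1 (hy ▸ mem_singleton_self y)
  refine not_hamOn_of_cut (X := X) (y := y) (T := Sᶜ) ?_ ?_ ?_ ?_ ?_ ?_ (hk S hS.le)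
  · intro x hx
    rw [mem_compl]
    exact fun h => disjoint_left.1 hdis hx (hSY h)
  · exact mem_compl.2 hyY.2
  · exact fun h => disjoint_left.1 hdis h hyY.1
  · exact card_pos.1 (by omega)
  · intro x hx v hv hvX hxv
    have : v ∈ Y \ S := mem_sdiff.2 ⟨(hadj x hx v hvX).1 hxv, mem_compl.1 hv⟩
    rw [hy] at this
    exact mem_singleton.1 this
  · intro h
    have h1 := (card_le_card h).trans (card_insert_le _ _)
    rw [card_compl] at h1
    omega

end NotHamiltonian

end KHam

/-! ### Assembly of the theorem -/

theorem theorem2p7 (k δ : ℕ) (hδ : k + 2 ≤ δ) :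
    ∃ N : ℕ, ∀ n : ℕ, N ≤ n →
      ∀ (V : Type*) [Fintype V] [DecidableEq V] (G : SimpleGraph V) [DecidableRel G.Adj],
        Fintype.card V = n →
        δ ≤ G.minDegree →
        2 * ((n : ℝ) - δ + k - 1) ≤ KHam.q G →
        (KHam.IsKHamiltonian G k ↔ ¬ (KHam.InFamilyH n k δ G ∨ KHam.InFamilyL n k δ G)) := by
  obtain ⟨s, rfl⟩ : ∃ s, δ = k + s := ⟨δ - k, by omega⟩
  have hs : 2 ≤ s := by omega
  obtain ⟨N₁, hN₁⟩ := KHam.exists_four_mul_card_missing_le s (k + s) (by omega)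
  obtain ⟨N₂, hN₂⟩ := KHam.exists_four_mul_card_missing_le s (k + 1) (by omega)
  -- `N₁` and `N₂` serve the sharp edge bounds for H and L, 2(k + s) + 2 keeps Z nonempty in both
  -- families, and the rest is the size needed for the structure theorem.
  refine ⟨N₁ + N₂ + 2 * (k + s) + 2 +
    (k + (10 * s + 4 * k + 6 + (s + 1) * (15 * s) + 2 * s * k)), ?_⟩
  intro n hn V _ _ G _ hV hmin hq
  subst hV
  have hdeg : ∀ v, k + s ≤ G.degree v := fun v => hmin.trans (G.minDegree_le_degree v)
  have hd : ∀ v, 0 < G.degree v := fun v => by have := hdeg v; omega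
  have : Nonempty V := Fintype.card_pos_iff.1 (by omega)
  have hq' : 2 * ((Fintype.card V : ℝ) - s - 1) ≤ KHam.q G := by
    push_cast at hq; linarith
  have hsk : k + s - k = s := by omega
  constructor
  · rintro h (hH | hL)
    · exact hH.not_isKHamiltonian (by omega) (by omega) h
    · exact hL.not_isKHamiltonian (by omega) (by omega) h
  · intro h
    by_contra hG
    rw [KHam.isKHamiltonian_iff] at hG
    push Not at hG
    obtain ⟨S, hS, hG⟩ := hG
    obtain ⟨X, Y, hdis, hX, hXY, ⟨hY, hcl⟩ | ⟨hY, hind⟩⟩ := KHam.exists_parts_of_not_hamOn hs hS hG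
      hdeg (KHam.sum_codegOn_le_of_le_q hd hq') (by omega)
    · refine h (Or.inr ?_)
      obtain ⟨E, hE, hEc, hφ⟩ := KHam.exists_iso_of_parts
        (z := Fintype.card V - (k + s) - 1) (s := k + s - k) (R := ⊤) hdis hXY
        (by rw [hX, hsk]) hY (by omega) (Or.inr ⟨rfl, hcl⟩)
      refine ⟨E, hE, ?_, hφ⟩
      have := hN₂ V G (by omega) hd X Y hdis hX hY hXY hq'
      rw [hEc, Nat.le_div_iff_mul_le (by norm_num), hsk, mul_comm, mul_comm (k + 1)]
      exact this
    · refine h (Or.inl ?_)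
      obtain ⟨E, hE, hEc, hφ⟩ := KHam.exists_iso_of_parts
        (z := Fintype.card V + k - 2 * (k + s)) (s := k + s - k) (R := ⊥) hdis hXY
        (by rw [hX, hsk]) hY (by omega) (Or.inl ⟨rfl, hind⟩)
      refine ⟨E, hE, ?_, hφ⟩
      have := hN₁ V G (by omega) hd X Y hdis hX hY hXY hq'
      rw [hEc, Nat.le_div_iff_mul_le (by norm_num), hsk, mul_comm, mul_comm (k + s)]
      exact this
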